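/- **Theorem 4.1 (undecidability of slice emptiness).** *Language.* Consider the first-order functional language with programs $d_1\cdots d_n\,e_{\mathbf{main}}$, function definitions $(\mathbf{define}\ (f\ z_1\cdots z_n)\ e_f)$, expressions $$e ::= (\mathbf{if}\ x\ e_1\ e_2)\mid(\mathbf{let}\ x\leftarrow s\ \mathbf{in}\ e)\mid(\mathbf{return}\ x)$$ and applications $$s ::= k\mid \mathbf{nil}\mid(\mathbf{cons}\ x\ y)\mid(\mathbf{car}\ x)\mid(\mathbf{cdr}\ x)\mid(\mathbf{null?}\ x)\mid(+\ x\ y)\mid(f\ x_1\cdots x_n).$$ Every expression, application and variable occurrence carries a unique label $\pi$, called a program point. All bound variables of a program are distinct, as are its function names; variables are used in scope, and every call is to a defined function with the right number of arguments. *Slicing criteria.* A slicing criterion $\sigma$ is a regular (right-linear) grammar over $\{\mathbf 0,\mathbf 1\}$ that generates a prefix-closed language. *Symbolic demand analysis.* The analysis takes a demand $\sigma$, which is a finite union of words over grammar symbols, and uses markers $\bar{\mathbf 0},\bar{\mathbf 1},\mathbf 2$ and a nonterminal $L_f^i$ for each parameter $z_i$ of each function $f$. It returns an environment that maps points to demands;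 here $\cup$ is pointwise union and a subterm is written $\pi_i{:}x$ together with its label: - $\mathcal A(\pi{:}k,\sigma)=\{\pi\mapsto\sigma\}$ for constants $k$, including $\mathbf{nil}$. For every other application $\mathcal A$ contains $\pi\mapsto\sigma$ and in addition: - for $\mathbf{cons}\ \pi_1{:}x\ \pi_2{:}y$: $\pi_1\mapsto\bar{\mathbf 0}\sigma$ and $\pi_2\mapsto\bar{\mathbf 1}\sigma$; - for $\mathbf{car}\ \pi_1{:}x$: $\pi_1\mapsto\mathbf 2\sigma\cup\mathbf 0\sigma$; - for $\mathbf{cdr}\ \pi_1{:}x$: $\pi_1\mapsto\mathbf 2\sigma\cup\mathbf 1\sigma$; - for $\mathbf{null?}$ and $+$: each argument $\mapsto\mathbf 2\sigma$; - for $f\ \pi_1{:}y_1\cdots\pi_n{:}y_n$: $\pi_i\mapsto L_f^i\,\sigma$ for $1\le i\le n$. - $\mathcal D(\pi{:}(\mathbf{return}\ \pi_1{:}x),\sigma)=\{\pi_1\mapsto\sigma,\ \pi\mapsto\sigma\}$. - $\mathcal D(\pi{:}(\mathbf{if}\ \pi_1{:}x\ e_1\ e_2),\sigma)=\mathcal D(e_1,\sigma)\cup\mathcal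 D(e_2,\sigma)\cup\{\pi_1\mapsto\mathbf 2\sigma,\ \pi\mapsto\sigma\}$. - $\mathcal D(\pi{:}(\mathbf{let}\ x\leftarrow s\ \mathbf{in}\ e),\sigma)=\mathrm{DE}\cup\mathcal A(s,\tau)\cup\{\pi\mapsto\sigma\}$, where $\mathrm{DE}=\mathcal D(e,\sigma)$ and $\tau$ is the union of $\mathrm{DE}(\pi')$ over the points $\pi'$ of the occurrences of $x$ in $e$. *The demand grammar.* For a program, one of its program points $\pi$ and a slicing criterion $\sigma$, let $G_\pi^\sigma$ be the unrestricted grammar with terminals $\mathbf 0,\mathbf 1,\$$ and all other symbols (in particular $\bar{\mathbf 0},\bar{\mathbf 1},\mathbf 2$) as nonterminals, with start symbol $D'_\pi$ and the following productions: - $D'_\pi\to D_\pi\,\$$; - for every function $f$, and for $\mathbf{main}$ with body $e_{\mathbf{main}}$: $D_{\pi'}\to w$ whenever $w$ is one of the words of $\mathcal D(e_f,\{\sigma_f\})(\pi')$; - $L_f^i\to w$ whenever $w$ is one of the words of $\mathcal D(e_f,\{\epsilon\})(\pi')$ for an occurrence $\pi'$ of the $i$-th parameter of $f$ in $e_f$;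 - $\sigma_f\to D_{\pi'}$ for every call site $\pi'$ of $f$ in the program; - the productions of the criterion $\sigma$, and $\sigma_{\mathbf{main}}\to$ its start symbol; - the five unrestricted simplification productions $$\bar{\mathbf 0}\mathbf 0\to\epsilon,\qquad \bar{\mathbf 1}\mathbf 1\to\epsilon,\qquad \mathbf 2\$\to\$,\qquad \mathbf 2\mathbf 0\to\mathbf 2,\qquad \mathbf 2\mathbf 1\to\mathbf 2 .$$ $\mathcal L(G_\pi^\sigma)$ is the set of words over $\{\mathbf 0,\mathbf 1,\$\}$ derivable from $D'_\pi$. *Claim.* The following problem is undecidable: given a program, a program point $\pi$ of it and a slicing criterion $\sigma$, is $\mathcal L(G_\pi^\sigma)$ empty? That is, for the explicit injective Gödel numbering of such triples by natural numbers that encodes syntax trees by iterated pairing, no total computable function decides this question correctly on the codes of all triples. -/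

import Mathlib

namespace Slicing

/-! ### Syntax of the first-order language in administrative normal form

Variables, function names and labels (program points) are natural numbers. Every expression, every
application and every variable occurrence carries its label. -/

/-- A labelled occurrence `π : x` of a variable. -/
structure Occ where
  label : ℕ
  var : ℕ

/-- Applications `π : s`. -/
inductive App where
  | const (π k : ℕ)
  | nil (π : ℕ)
  | cons (π : ℕ) (x y : Occ)
  | car (π : ℕ) (x : Occ)
  | cdr (π : ℕ) (x : Occ)
  | isNull (π : ℕ) (x : Occ)
  | prim (π : ℕ) (x y : Occ)
  | call (π f : ℕ) (args : List Occ)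

/-- Expressions `π : e`: `(if x e₁ e₂)`, `(let x ← s in e)` and `(return x)`. -/
inductive Expr where
  | ite (π : ℕ) (x : Occ) (e₁ e₂ : Expr)
  | letIn (π x : ℕ) (s : App) (e : Expr)
  | ret (π : ℕ) (x : Occ)

/-- A function definition `(define (f z₁ … zₙ) e)`. -/
structure FunDef where
  name : ℕ
  params : List ℕ
  body : Expr

/-- A program `d₁ … dₙ e_main`. -/
structure Program where
  defs : List FunDef
  main : Expr

/-- The label of an application. -/
def App.label : App → ℕ
  | .const π _ => π
  | .nil π => π
  | .cons π _ _ => π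
  | .car π _ => π
  | .cdr π _ => π
  | .isNull π _ => π
  | .prim π _ _ => π
  | .call π _ _ => π

/-- The variable occurrences in an application. -/
def App.occs : App → List Occ
  | .const _ _ => []
  | .nil _ => []
  | .cons _ x y => [x, y]
  | .car _ x => [x]
  | .cdr _ x => [x]
  | .isNull _ x => [x]
  | .prim _ x y => [x, y]
  | .call _ _ args => args

/-- The variable occurrences in an expression (binding positions are not occurrences). -/
def Expr.occs : Expr → List Occ
  | .ite _ x e₁ e₂ => x :: (e₁.occs ++ e₂.occs)
  | .letIn _ _ s e => s.occs ++ e.occs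
  | .ret _ x => [x]

/-- The applications in an expression. -/
def Expr.apps : Expr → List App
  | .ite _ _ e₁ e₂ => e₁.apps ++ e₂.apps
  | .letIn _ _ s e => s :: e.apps
  | .ret _ _ => []

/-- The labels of the subexpressions of an expression (itself included). -/
def Expr.exprLabels : Expr → List ℕ
  | .ite π _ e₁ e₂ => π :: (e₁.exprLabels ++ e₂.exprLabels)
  | .letIn π _ _ e => π :: e.exprLabels
  | .ret π _ => [π]

/-- All program points of an expression. -/
def Expr.labels (e : Expr) : List ℕ :=
  e.exprLabels ++ e.apps.map App.label ++ e.occs.map Occ.label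

/-- The variables bound by the `let`s of an expression. -/
def Expr.letVars : Expr → List ℕ
  | .ite _ _ e₁ e₂ => e₁.letVars ++ e₂.letVars
  | .letIn _ x _ e => x :: e.letVars
  | .ret _ _ => []

/-- Every variable occurrence of the expression is bound in it or belongs to `scope`. -/
def Expr.Scoped : List ℕ → Expr → Prop
  | scope, .ite _ x e₁ e₂ => x.var ∈ scope ∧ e₁.Scoped scope ∧ e₂.Scoped scope
  | scope, .letIn _ x s e => (∀ o ∈ s.occs, o.var ∈ scope) ∧ e.Scoped (x :: scope)
  | scope, .ret _ x => x.var ∈ scope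

/-- The labels of the occurrences of the variable `x` in `e`. -/
def Expr.occLabels (e : Expr) (x : ℕ) : List ℕ :=
  (e.occs.filter fun o => o.var = x).map Occ.label

/-- The labels of the calls to `f` in `e`. -/
def Expr.callSites (e : Expr) (f : ℕ) : List ℕ :=
  e.apps.filterMap fun s =>
    match s with
    | .call π g _ => if g = f then some π else none
    | _ => none

/-- The function bodies of a program, and its main expression. -/
def Program.bodies (p : Program) : List Expr :=
  p.main :: p.defs.map FunDef.body

/-- The program points of a program. -/
def Program.labels (p : Program) : List ℕ :=
  p.bodies.flatMap Expr.labels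

/-- Programs in the sense of the language: labels are unique, function names are distinct, all
variables of the program are distinct, variables are in scope where they are used, and every call
is to a defined function with the right number of arguments. -/
structure Program.WellFormed (p : Program) : Prop where
  labels_nodup : p.labels.Nodup
  names_nodup : (p.defs.map FunDef.name).Nodup
  vars_nodup : (p.defs.flatMap FunDef.params ++ p.bodies.flatMap Expr.letVars).Nodup
  scoped_main : p.main.Scoped []
  scoped_defs : ∀ d ∈ p.defs, d.body.Scoped d.params
  calls : ∀ e ∈ p.bodies, ∀ π f args, App.call π f args ∈ e.apps →
    ∃ d ∈ p.defs, d.name = f ∧ d.params.length = args.length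

/-! ### Slicing criteria -/

/-- The selectors `0` (dereference the `car` field) and `1` (dereference the `cdr` field). -/
inductive Sel where
  | zero
  | one

/-- A production `A → w B` or `A → w` of a right-linear grammar over the selectors. -/
structure RProd where
  lhs : ℕ
  word : List Sel
  next : Option ℕ

/-- A regular (right-linear) grammar over the selectors. -/
structure Criterion where
  start : ℕ
  prods : List RProd

/-- `c.Gen A w`: the nonterminal `A` of `c` generates the access path `w`. -/
inductive Criterion.Gen (c : Criterion) : ℕ → List Sel → Prop
  | last {A : ℕ} {w : List Sel} (h : RProd.mk A w none ∈ c.prods) : c.Gen A w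
  | step {A B : ℕ} {w v : List Sel} (h : RProd.mk A w (some B) ∈ c.prods) (hv : c.Gen B v) :
      c.Gen A (w ++ v)

/-- The demand represented by a criterion is prefix-closed. -/
def Criterion.PrefixClosed (c : Criterion) : Prop :=
  ∀ u v : List Sel, c.Gen c.start (u ++ v) → c.Gen c.start u

/-! ### Unrestricted grammars -/

/-- An unrestricted grammar with terminals `T` and nonterminals `N`. -/
structure UGrammar (T N : Type) where
  start : N
  rules : List (List (Symbol T N) × List (Symbol T N))

/-- One rewriting step. -/
def UGrammar.Produces {T N : Type} (G : UGrammar T N) (u v : List (Symbol T N)) : Prop :=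
  ∃ r ∈ G.rules, ∃ p q, u = p ++ r.1 ++ q ∧ v = p ++ r.2 ++ q

/-- The set of the terminal words that are derivable from the start symbol. -/
def UGrammar.language {T N : Type} (G : UGrammar T N) : Set (List T) :=
  {w | Relation.ReflTransGen G.Produces [Symbol.nonterminal G.start] (w.map Symbol.terminal)}

/-! ### Demand analysis with symbolic demands -/

/-- The terminals `0`, `1` and the end marker `$`. -/
inductive Terminal where
  | sel (a : Sel)
  | eos

/-- The nonterminals. The markers `0̄`, `1̄` (`bar`) and `2` (`two`) of the symbolic analysis are
listed here because they head the productions that simplify them away, and so do not occur in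
the words of the language.

`demand π` is the demand at `π`, `summary f i` the summary of the `i`-th parameter of `f` (counted
from `0`), `body f` the concrete demand on the body of `f`, `bodyMain` that on the main expression,
`crit n` a nonterminal of the slicing criterion, and `start` the start symbol. -/
inductive NT where
  | start
  | demand (π : ℕ)
  | summary (f i : ℕ)
  | body (f : ℕ)
  | bodyMain
  | crit (n : ℕ)
  | bar (a : Sel)
  | two

/-- Grammar symbols. -/
abbrev Sym := Symbol Terminal NT

/-- A symbolic demand: a finite union of words. -/
abbrev Demand := List (List Sym)

/-- A symbolic demand environment: the demand that it assigns to `π` is the union of all `w` such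
that `(π, w)` is in the list. -/
abbrev DemandEnv := List (ℕ × List Sym)

/-- The selector `a` as a grammar symbol. -/
def sel (a : Sel) : Sym := .terminal (.sel a)

/-- The end marker `$` as a grammar symbol. -/
def eos : Sym := .terminal .eos

/-- The marker `ā` as a grammar symbol. -/
def bar (a : Sel) : Sym := .nonterminal (.bar a)

/-- The marker `2` as a grammar symbol. -/
def two : Sym := .nonterminal .two

/-- The demand `aσ`. -/
def Demand.pre (a : Sym) (σ : Demand) : Demand := σ.map (a :: ·)

/-- The environment `{π ↦ σ}`. -/
def assign (π : ℕ) (σ : Demand) : DemandEnv := σ.map fun w => (π, w)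

/-- The union of the demands of the points in `pts` under an environment. -/
def demandAt (DE : DemandEnv) (pts : List ℕ) : Demand :=
  (DE.filter fun q => q.1 ∈ pts).map Prod.snd

/-- The analysis `𝒜` of an application under the demand `σ`. -/
def App.analyze : App → Demand → DemandEnv
  | .const π _, σ => assign π σ
  | .nil π, σ => assign π σ
  | .cons π x y, σ =>
      assign x.label (σ.pre (bar .zero)) ++ assign y.label (σ.pre (bar .one)) ++ assign π σ
  | .car π x, σ => assign x.label (σ.pre two ++ σ.pre (sel .zero)) ++ assign π σ
  | .cdr π x, σ => assign x.label (σ.pre two ++ σ.pre (sel .one)) ++ assign π σ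
  | .isNull π x, σ => assign x.label (σ.pre two) ++ assign π σ
  | .prim π x y, σ => assign x.label (σ.pre two) ++ assign y.label (σ.pre two) ++ assign π σ
  | .call π f args, σ =>
      (args.zipIdx.flatMap fun yi =>
        assign yi.1.label (σ.pre (.nonterminal (.summary f yi.2)))) ++ assign π σ

/-- The analysis `𝒟` of an expression under the demand `σ`. -/
def Expr.analyze : Expr → Demand → DemandEnv
  | .ret π x, σ => assign x.label σ ++ assign π σ
  | .ite π x e₁ e₂, σ =>
      e₁.analyze σ ++ e₂.analyze σ ++ assign x.label (σ.pre two) ++ assign π σ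
  | .letIn π x s e, σ =>
      e.analyze σ ++ s.analyze (demandAt (e.analyze σ) (e.occLabels x)) ++ assign π σ

/-! ### The demand grammar -/

/-- Productions. -/
abbrev Rule := List Sym × List Sym

/-- The context-free production `A → w`. -/
def NT.to (A : NT) (w : List Sym) : Rule := ([.nonterminal A], w)

/-- The productions of the demands at the points of a body `e`, when `A` is the nonterminal of the
concrete demand on `e`. -/
def demandRules (e : Expr) (A : NT) : List Rule :=
  (e.analyze [[.nonterminal A]]).map fun q => (NT.demand q.1).to q.2

/-- The productions of the summaries of a function: the union of the demands of the occurrences of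
each parameter. The analysis only puts symbols in front of the symbolic demand `σ`; the summary
`L` with `L σ` the demand of the parameter is what is obtained by taking `σ = {ε}`. -/
def summaryRules (d : FunDef) : List Rule :=
  d.params.zipIdx.flatMap fun zi =>
    (demandAt (d.body.analyze [[]]) (d.body.occLabels zi.1)).map fun w => (NT.summary d.name zi.2).to w

/-- The productions of the concrete demand on the body of `f`: the union of the demands at all
call sites of `f`. -/
def bodyRules (p : Program) (f : ℕ) : List Rule :=
  (p.bodies.flatMap fun e => e.callSites f).map fun π => (NT.body f).to [.nonterminal (.demand π)]

/-- The productions of the slicing criterion, which is the demand on the main expression. -/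
def critRules (c : Criterion) : List Rule :=
  NT.bodyMain.to [.nonterminal (.crit c.start)] ::
    c.prods.map fun r =>
      (NT.crit r.lhs).to (r.word.map sel ++ (r.next.toList.map fun B => .nonterminal (.crit B)))

/-- The context-free productions that come from the demand analysis of `p` for the criterion `c`. -/
def contextFreeRules (p : Program) (c : Criterion) : List Rule :=
  demandRules p.main .bodyMain ++ (p.defs.flatMap fun d => demandRules d.body (.body d.name)) ++
    p.defs.flatMap summaryRules ++ (p.defs.flatMap fun d => bodyRules p d.name) ++ critRules c

/-- The five unrestricted productions that carry out the simplification. -/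
def unrestrictedRules : List Rule :=
  [([bar .zero, sel .zero], []),
   ([bar .one, sel .one], []),
   ([two, eos], [eos]),
   ([two, sel .zero], [two]),
   ([two, sel .one], [two])]

/-- The grammar of the program point `π` of `p` for the criterion `c`. -/
def sliceGrammar (p : Program) (π : ℕ) (c : Criterion) : UGrammar Terminal NT where
  start := .start
  rules := contextFreeRules p c ++ unrestrictedRules ++
    [NT.start.to [.nonterminal (.demand π), eos]]

/-! ### The decision problem -/

/-- Gödel numbers of labelled occurrences. -/
def Occ.code (o : Occ) : ℕ := Nat.pair o.label o.var

/-- Gödel numbers of applications. -/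
def App.code : App → ℕ
  | .const π k => Nat.pair 0 (Nat.pair π k)
  | .nil π => Nat.pair 1 π
  | .cons π x y => Nat.pair 2 (Nat.pair π (Nat.pair x.code y.code))
  | .car π x => Nat.pair 3 (Nat.pair π x.code)
  | .cdr π x => Nat.pair 4 (Nat.pair π x.code)
  | .isNull π x => Nat.pair 5 (Nat.pair π x.code)
  | .prim π x y => Nat.pair 6 (Nat.pair π (Nat.pair x.code y.code))
  | .call π f args => Nat.pair 7 (Nat.pair π (Nat.pair f (Encodable.encode (args.map Occ.code))))

/-- Gödel numbers of expressions. -/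
def Expr.code : Expr → ℕ
  | .ite π x e₁ e₂ => Nat.pair 0 (Nat.pair π (Nat.pair x.code (Nat.pair e₁.code e₂.code)))
  | .letIn π x s e => Nat.pair 1 (Nat.pair π (Nat.pair x (Nat.pair s.code e.code)))
  | .ret π x => Nat.pair 2 (Nat.pair π x.code)

/-- Gödel numbers of function definitions. -/
def FunDef.code (d : FunDef) : ℕ :=
  Nat.pair d.name (Nat.pair (Encodable.encode d.params) d.body.code)

/-- Gödel numbers of programs. -/
def Program.code (p : Program) : ℕ :=
  Nat.pair (Encodable.encode (p.defs.map FunDef.code)) p.main.code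

/-- Gödel numbers of selectors. -/
def Sel.code : Sel → ℕ
  | .zero => 0
  | .one => 1

/-- Gödel numbers of the productions of a criterion. -/
def RProd.code (r : RProd) : ℕ :=
  Nat.pair r.lhs (Nat.pair (Encodable.encode (r.word.map Sel.code)) (Encodable.encode r.next))

/-- Gödel numbers of criteria. -/
def Criterion.code (c : Criterion) : ℕ :=
  Nat.pair c.start (Encodable.encode (c.prods.map RProd.code))

/-- An instance of the problem: a program, a program point and a slicing criterion. -/
structure SliceQuery where
  prog : Program
  point : ℕ
  crit : Criterion

/-- The program is well formed, the point belongs to it and the criterion is prefix-closed. -/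
structure SliceQuery.WellFormed (I : SliceQuery) : Prop where
  prog : I.prog.WellFormed
  point : I.point ∈ I.prog.labels
  crit : I.crit.PrefixClosed

/-- The grammar of an instance. -/
def SliceQuery.grammar (I : SliceQuery) : UGrammar Terminal NT :=
  sliceGrammar I.prog I.point I.crit

/-- Gödel numbers of instances. -/
def SliceQuery.code (I : SliceQuery) : ℕ :=
  Nat.pair I.prog.code (Nat.pair I.point I.crit.code)

/-! Different instances have different Gödel numbers. -/

theorem Occ.code_injective : Function.Injective Occ.code := by
  rintro ⟨a, b⟩ ⟨c, d⟩ h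
  simpa [Occ.code, Nat.pair_eq_pair] using h

theorem App.code_injective : Function.Injective App.code := by
  intro s t h
  have hl := (List.map_injective_iff.2 Occ.code_injective)
  cases s <;> cases t <;>
    simp only [App.code, Nat.pair_eq_pair, Encodable.encode_inj, Occ.code_injective.eq_iff,
      hl.eq_iff] at h <;> simp_all

theorem Expr.code_injective : Function.Injective Expr.code := by
  intro e
  induction e with
  | ite π x e₁ e₂ h₁ h₂ =>
    intro t h
    cases t <;> simp only [Expr.code, Nat.pair_eq_pair, Occ.code_injective.eq_iff] at h
    · obtain ⟨-, rfl, rfl, a, b⟩ := h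
      rw [h₁ a, h₂ b]
    all_goals omega
  | letIn π x s e he =>
    intro t h
    cases t <;> simp only [Expr.code, Nat.pair_eq_pair, App.code_injective.eq_iff] at h
    · omega
    · obtain ⟨-, rfl, rfl, rfl, b⟩ := h
      rw [he b]
    · omega
  | ret π x =>
    intro t h
    cases t <;> simp only [Expr.code, Nat.pair_eq_pair, Occ.code_injective.eq_iff] at h
    · omega
    · omega
    · obtain ⟨-, rfl, rfl⟩ := h
      rfl

theorem FunDef.code_injective : Function.Injective FunDef.code := by
  rintro ⟨a, b, c⟩ ⟨a', b', c'⟩ h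
  simpa [FunDef.code, Nat.pair_eq_pair, Expr.code_injective.eq_iff] using h

theorem Program.code_injective : Function.Injective Program.code := by
  rintro ⟨a, b⟩ ⟨a', b'⟩ h
  simpa [Program.code, Nat.pair_eq_pair, Expr.code_injective.eq_iff,
    (List.map_injective_iff.2 FunDef.code_injective).eq_iff] using h

theorem Sel.code_injective : Function.Injective Sel.code := by
  intro a b h
  cases a <;> cases b <;> simp_all [Sel.code]

theorem RProd.code_injective : Function.Injective RProd.code := by
  rintro ⟨a, b, c⟩ ⟨a', b', c'⟩ h
  simpa [RProd.code, Nat.pair_eq_pair,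
    (List.map_injective_iff.2 Sel.code_injective).eq_iff] using h

theorem Criterion.code_injective : Function.Injective Criterion.code := by
  rintro ⟨a, b⟩ ⟨a', b'⟩ h
  simpa [Criterion.code, Nat.pair_eq_pair,
    (List.map_injective_iff.2 RProd.code_injective).eq_iff] using h

theorem SliceQuery.code_injective : Function.Injective SliceQuery.code := by
  rintro ⟨a, b, c⟩ ⟨a', b', c'⟩ h
  simpa [SliceQuery.code, Nat.pair_eq_pair, Program.code_injective.eq_iff,
    Criterion.code_injective.eq_iff] using h

end Slicing

/-! ### Turing machines whose halting on one-parameter inputs is undecidable -/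

namespace Slicing
open Turing

/-! The halting problem is reduced to nonemptiness for one fixed program and point; only the
criterion depends on the instance.

Read a demand word from right to left as a sequence of operations on an access path, regarded as a
stack: a selector pushes itself, a barred selector pops it, and `2` clears the stack. The summary
nonterminal of a one-parameter function is then a nondeterministic, recursive stack procedure. `car`
and `cdr` push, `cons` pops, `if` chooses and nested calls compose. Recursion supplies a second,
implicit stack, so a Turing machine can be simulated: the tape from the head rightwards is on the
explicit stack, and the cells left of the head are the pending calls (`simSpec_of_den`,
`exec_of_haltsIn`). A procedure for a state returns when the head leaves its part of the tape to the
left, or when the machine has halted.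

Two effects could produce spurious words. `car`, `cdr` and `if` also contribute a `2`, so a run may
clear the stack at any push or choice; and prefix closure forces the criterion to generate all
prefixes of the intended input. The encoding defeats both. Letters become `1…10` and the bottom of
the stack is a final `0`, which is popped at the very end. Clearing and taking a proper prefix both
lose the end marker, and no command restores it (`Com.translateSpec_of_exec`,
`truncated_of_prefix`).

Soundness comes from a model: nonterminals denote relations between stacks such that each
production's right-hand side is contained in its left-hand side, and a terminal word denotes a total
relation, so a derivable word makes the start relation nonempty (`exists_of_mem_language`).
Conversely, a run without clearing is turned into a derivation (`SummaryReaches.of_den`).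

Since the simulation cannot see the end of the tape on the right, the criterion offers the input
followed by any number of blanks. Blanks on the left are supplied by the procedure `sim`. -/

/-- The halting problem, as a predicate on the index of a program that is run on the input `0`. -/
theorem not_computablePred_eval_ofNat :
    ¬ ComputablePred fun n : ℕ => (Nat.Partrec.Code.eval (Denumerable.ofNat Nat.Partrec.Code n) 0).Dom := by
  intro h
  refine ComputablePred.halting_problem 0 ?_
  obtain ⟨f, hf, h⟩ := ComputablePred.computable_iff.1 h
  refine ComputablePred.computable_iff.2 ⟨fun c => f (Encodable.encode c), hf.comp Computable.encode, ?_⟩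
  funext c
  simpa using congrFun h (Encodable.encode c)

/-- Powers of two are chosen because their binary expansion, the input format of the Turing machine
compilation, repeats one letter `n` times beside a fixed part; a regular criterion can then describe
the input. The partial function recovers `n` from `2 ^ n` by search and runs the `n`-th code on `0`.
-/
theorem exists_code_eval_two_pow :
    ∃ c : ToPartrec.Code, ¬ ComputablePred fun n : ℕ => (c.eval [2 ^ n]).Dom := by
  let g : ℕ →. ℕ := fun m => (Nat.rfind fun n => Part.some (decide (2 ^ n = m))).bind
    fun n => Nat.Partrec.Code.eval (Denumerable.ofNat Nat.Partrec.Code n) 0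
  have hpow : Primrec₂ fun (m n : ℕ) => decide (2 ^ n = m) := by
    have h2 : Primrec fun n : ℕ => 2 ^ n :=
      (Primrec.nat_rec₁ 1 (Primrec.nat_mul.comp (Primrec.const 2) Primrec.snd).to₂).of_eq
        fun n => by induction n <;> simp_all [pow_succ, mul_comm]
    exact PrimrecRel.decide (Primrec.eq.comp (h2.comp Primrec.snd) Primrec.fst)
  have hg : Partrec g := by
    refine Partrec.bind (Partrec.rfind hpow.to_comp.partrec₂) ?_
    exact (Nat.Partrec.Code.eval_part.comp ((Computable.ofNat Nat.Partrec.Code).comp Computable.snd)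
      (Computable.const 0))
  have hv : ∀ n, g (2 ^ n) = Nat.Partrec.Code.eval (Denumerable.ofNat Nat.Partrec.Code n) 0 := by
    intro n
    have : (Nat.rfind fun k => Part.some (decide (2 ^ k = 2 ^ n))) = Part.some n := by
      refine Part.eq_some_iff.2 (Nat.mem_rfind.2 ⟨by simp, fun {m} hm => ?_⟩)
      simp [hm.ne]
    simp only [g, this, Part.bind_some]
  obtain ⟨c, hc⟩ := ToPartrec.Code.exists_code (Nat.Partrec'.part_iff₁.2 hg)
  refine ⟨c, fun h => not_computablePred_eval_ofNat ?_⟩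
  convert h using 2 with n
  have := hc ⟨[2 ^ n], rfl⟩
  simp only [List.Vector.head] at this
  rw [show c.eval [2 ^ n] = _ from this, hv n]
  simp

theorem trNat_two_pow (n : ℕ) :
    PartrecToTM2.trNat (2 ^ n) = List.replicate n PartrecToTM2.Γ'.bit0 ++ [PartrecToTM2.Γ'.bit1] := by
  have h : ((2 ^ n : ℕ) : Num) = Num.pos (n.rec PosNum.one fun _ p => p.bit0) := by
    induction n with
    | zero => rfl
    | succ n ih =>
      rw [pow_succ, mul_comm, two_mul, Nat.cast_add, ih, Num.bit0_of_bit0]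
      rfl
  rw [PartrecToTM2.trNat, h]
  simp only [PartrecToTM2.trNum]
  clear h
  induction n with
  | zero => rfl
  | succ n ih => simpa [PartrecToTM2.trPosNum, List.replicate_succ] using ih

instance : Fintype PartrecToTM2.K' :=
  ⟨{.main, .rev, .aux, .stack}, fun x => by cases x <;> simp⟩

/-- A Turing machine with finitely many states and symbols whose halting on the inputs
`pre ++ [z, …, z]` is undecidable. -/
theorem exists_turing_machine : ∃ (Γ Q : Type) (_ : Fintype Γ) (_ : Fintype Q) (_ : Inhabited Γ)
    (_ : Inhabited Q) (M : TM0.Machine Γ Q) (pre : List Γ) (z : Γ),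
    ¬ ComputablePred fun n : ℕ => (TM0.eval M (pre ++ List.replicate n z)).Dom := by
  classical
  obtain ⟨c, hc⟩ := exists_code_eval_two_pow
  let _ : Inhabited PartrecToTM2.Λ' := ⟨PartrecToTM2.trNormal c PartrecToTM2.Cont'.halt⟩
  let M1 := TM2to1.tr PartrecToTM2.tr
  let M0 := TM1to0.tr M1
  have hs := TM1to0.tr_supports M1 (TM2to1.tr_supports PartrecToTM2.tr
    (PartrecToTM2.tr_supports c PartrecToTM2.Cont'.halt))
  set S := TM1to0.trStmts M1
    (TM2to1.trSupp PartrecToTM2.tr (PartrecToTM2.codeSupp c PartrecToTM2.Cont'.halt))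
  let _ : Inhabited S := ⟨⟨default, hs.1⟩⟩
  let f : PointedMap (TM2to1.Γ' PartrecToTM2.K' fun _ => PartrecToTM2.Γ')
    (TM2to1.Γ' PartrecToTM2.K' fun _ => PartrecToTM2.Γ') := ⟨id, rfl⟩
  -- The compiled machine has an infinite type of states but a finite support `S` closed under its
  -- steps. Sending the states outside `S` to the default one therefore does not affect the run.
  let g₁ : PointedMap (TM1to0.Λ' M1) S :=
    ⟨fun q => if h : q ∈ S then ⟨q, h⟩ else default, dif_pos hs.1⟩
  let sym : Bool → PartrecToTM2.Γ' → TM2to1.Γ' PartrecToTM2.K' fun _ => PartrecToTM2.Γ' :=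
    fun b a => (b, Function.update (fun _ => none) PartrecToTM2.K'.main (some a))
  -- The stack is laid out bottom first, so the little-endian digits of `2 ^ n` are reversed and the
  -- zeros come last; `true` flags the bottom cell.
  have hin : ∀ n, [sym true .cons, sym false .bit1] ++ List.replicate n (sym false .bit0) =
      TM2to1.trInit PartrecToTM2.K'.main (PartrecToTM2.trList [2 ^ n]) := by
    intro n
    simp only [TM2to1.trInit, PartrecToTM2.trList, trNat_two_pow, List.append_assoc,
      List.reverse_append, List.reverse_cons, List.reverse_nil, List.nil_append, List.cons_append,
      List.reverse_replicate]
    exact congrArg (fun l => sym true .cons :: sym false .bit1 :: l) List.map_replicate.symm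
  have hM : ∀ l, (TM0.eval (M0.map f f g₁ Subtype.val) l).Dom ↔ (TM0.eval M0 l).Dom := by
    intro l
    have h := StateTransition.tr_eval_dom (TM0.Machine.map_respects M0 f f g₁ Subtype.val hs
      (fun _ => rfl) (fun q hq => congrArg Subtype.val (dif_pos hq)))
      (a₁ := TM0.init l) ⟨hs.1, rfl⟩
    rw [TM0.map_init] at h
    have e : l.map f = l := List.map_id l
    rw [e] at h
    exact h
  have h2 : ∀ n, (TM2.eval PartrecToTM2.tr PartrecToTM2.K'.main (PartrecToTM2.trList [2 ^ n])).Dom ↔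
      (c.eval [2 ^ n]).Dom := by
    intro n
    have e : TM2.init PartrecToTM2.K'.main (PartrecToTM2.trList [2 ^ n]) =
        PartrecToTM2.init c [2 ^ n] := by
      simp only [TM2.init, PartrecToTM2.init]
      congr 1
      funext k
      cases k <;> rfl
    have h := PartrecToTM2.tr_eval c [2 ^ n]
    simp only [TM2.eval, Part.map_Dom]
    rw [e, h]
    rfl
  refine ⟨TM2to1.Γ' PartrecToTM2.K' fun _ => PartrecToTM2.Γ', S, inferInstance, inferInstance,
    inferInstance, inferInstance, M0.map f f g₁ Subtype.val,
    [sym true .cons, sym false .bit1], sym false .bit0, ?_⟩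
  have : ∀ n, (TM0.eval (M0.map f f g₁ Subtype.val) ([sym true .cons, sym false .bit1] ++
      List.replicate n (sym false .bit0))).Dom ↔ (c.eval [2 ^ n]).Dom := by
    intro n
    rw [hin, hM, TM1to0.tr_eval]
    exact (TM2to1.tr_eval_dom _ _ _).trans (h2 n)
  simpa only [this] using hc

end Slicing

/-! ### Recursive commands on a single stack -/

namespace Slicing
open Turing

/-- Nondeterministic commands acting on one stack over `A`, with recursive procedures from `F`. -/
inductive Com (F A : Type) where
  | skip
  | fail
  | push (a : A)
  | pop (a : A)
  | alt (c d : Com F A)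
  | seq (c d : Com F A)
  | call (f : F)

/-- Big-step semantics of commands. If `κ` holds, then some commands may also clear the stack. -/
inductive Com.Exec {F A : Type} (sys : F → Com F A) (κ : Prop) :
    Com F A → List A → List A → Prop
  | skip (s) : Exec sys κ .skip s s
  | push (a s) : Exec sys κ (.push a) s (a :: s)
  | pop (a s) : Exec sys κ (.pop a) (a :: s) s
  | altl {c d s t} (h : Exec sys κ c s t) : Exec sys κ (.alt c d) s t
  | altr {c d s t} (h : Exec sys κ d s t) : Exec sys κ (.alt c d) s t
  | seq {c d s t u} (h₁ : Exec sys κ c s t) (h₂ : Exec sys κ d t u) : Exec sys κ (.seq c d) s u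
  | call {f s t} (h : Exec sys κ (sys f) s t) : Exec sys κ (.call f) s t
  | clearFail (h : κ) (s) : Exec sys κ .fail s []
  | clearPush (h : κ) (a s) : Exec sys κ (.push a) s []
  | clearAlt (h : κ) (c d s) : Exec sys κ (.alt c d) s []
  | clearCall (h : κ) (f s) : Exec sys κ (.call f) s []

namespace Com

variable {F A : Type}

/-- The relation denoted by a command when procedures denote the relations `S`. -/
def Den (κ : Prop) (S : F → List A → List A → Prop) : Com F A → List A → List A → Prop
  | .skip, s, t => t = s
  | .fail, _, t => κ ∧ t = []
  | .push a, s, t => t = a :: s ∨ κ ∧ t = []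
  | .pop a, s, t => s = a :: t
  | .alt c d, s, t => Den κ S c s t ∨ Den κ S d s t ∨ κ ∧ t = []
  | .seq c d, s, t => ∃ u, Den κ S c s u ∧ Den κ S d u t
  | .call f, s, t => S f s t ∨ κ ∧ t = []

/-- Execution is the least relation closed under the procedure bodies, so any interpretation `S`
closed under them bounds it. All soundness arguments about runs use this induction principle. -/
theorem Exec.den {sys : F → Com F A} {κ : Prop} {S : F → List A → List A → Prop}
    (hS : ∀ f s t, Den κ S (sys f) s t → S f s t) {c : Com F A} {s t : List A}
    (h : Exec sys κ c s t) : Den κ S c s t := by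
  induction h with
  | skip | pop | push => simp [Den]
  | altl _ ih => exact .inl ih
  | altr _ ih => exact .inr (.inl ih)
  | seq _ _ ih₁ ih₂ => exact ⟨_, ih₁, ih₂⟩
  | call _ ih => exact .inl (hS _ _ _ ih)
  | clearFail h => exact ⟨h, rfl⟩
  | clearPush h => exact .inr ⟨h, rfl⟩
  | clearAlt h => exact .inr (.inr ⟨h, rfl⟩)
  | clearCall h => exact .inr ⟨h, rfl⟩

/-- Nondeterministic choice from a list. -/
def alts : List (Com F A) → Com F A
  | [] => .fail
  | c :: l => .alt c (alts l)

/-- Push the letters of a word, so that the word appears on top of the stack. -/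
def pushWord : List A → Com F A
  | [] => .skip
  | a :: w => .seq (pushWord w) (.push a)

/-- Pop the letters of a word. -/
def popWord : List A → Com F A
  | [] => .skip
  | a :: w => .seq (.pop a) (popWord w)

theorem exec_alts {sys : F → Com F A} {κ : Prop} {l : List (Com F A)} {c : Com F A} (hc : c ∈ l)
    {s t : List A} (h : Exec sys κ c s t) : Exec sys κ (alts l) s t := by
  induction l with
  | nil => simp at hc
  | cons d l ih =>
    rcases List.mem_cons.1 hc with rfl | hc
    · exact .altl h
    · exact .altr (ih hc)

theorem exec_pushWord {sys : F → Com F A} {κ : Prop} (w s : List A) :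
    Exec sys κ (pushWord w) s (w ++ s) := by
  induction w with
  | nil => exact .skip s
  | cons a w ih => exact .seq ih (.push a _)

theorem exec_popWord {sys : F → Com F A} {κ : Prop} (w s : List A) :
    Exec sys κ (popWord w) (w ++ s) s := by
  induction w with
  | nil => exact .skip s
  | cons a w ih => exact .seq (.pop a _) ih

theorem den_alts {S : F → List A → List A → Prop} {l : List (Com F A)} {s t : List A} :
    Den False S (alts l) s t ↔ ∃ c ∈ l, Den False S c s t := by
  induction l with
  | nil => simp [alts, Den]
  | cons c l ih => simp [alts, Den, ih]

theorem den_pushWord {S : F → List A → List A → Prop} {w s t : List A} :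
    Den False S (pushWord w) s t ↔ t = w ++ s := by
  induction w generalizing t with
  | nil => simp [pushWord, Den]
  | cons a w ih => simp [pushWord, Den, ih]

theorem den_popWord {κ : Prop} {S : F → List A → List A → Prop} {w s t : List A} :
    Den κ S (popWord w) s t ↔ s = w ++ t := by
  induction w generalizing s with
  | nil => simp [popWord, Den, eq_comm]
  | cons a w ih => simp [popWord, Den, ih]

/-- Letters are pushed from the last to the first. After a clearing in place of some letter, only
the letters before it can still arrive, which leaves a proper prefix of the word. -/
theorem den_pushWord_clear {κ : Prop} {S : F → List A → List A → Prop} {w s t : List A}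
    (h : Den κ S (pushWord w) s t) : t = w ++ s ∨ ∃ a v, w = t ++ a :: v := by
  induction w generalizing t with
  | nil => exact .inl h
  | cons a w ih =>
    obtain ⟨u, h₁, rfl | ⟨-, rfl⟩⟩ := h
    · rcases ih h₁ with rfl | ⟨b, v, rfl⟩
      · exact .inl rfl
      · exact .inr ⟨b, v, rfl⟩
    · exact .inr ⟨a, w, rfl⟩

end Com

/-! ### Simulation of Turing machines -/

/-- The letters on the stack of the simulation: tape symbols, states in transit to the left, and
the signal that the machine has halted. -/
inductive Cell (Γ Q : Type) where
  | sym (a : Γ)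
  | st (q : Q)
  | halt

/-- The procedures of the simulation: machine states, tape symbols to the left of the head, the
simulation of a run, and the removal of tape symbols. -/
inductive Proc (Γ Q : Type) where
  | state (q : Q)
  | left (a : Γ)
  | sim
  | popAll

section Simulation

variable {Γ Q : Type} [Inhabited Γ] [Inhabited Q] (M : TM0.Machine Γ Q)

/-- The reaction to reading `a` in state `q`. -/
def readCom (q : Q) (a : Γ) : Com (Proc Γ Q) (Cell Γ Q) :=
  match M q a with
  | none => .seq (.push (.sym a)) (.push .halt)
  | some (p, .write b) => .seq (.push (.sym b)) (.call (.state p))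
  | some (p, .move .right) => .seq (.call (.state p)) (.call (.left a))
  | some (p, .move .left) => .seq (.push (.sym a)) (.push (.st p))

/-- Run the machine on the word on the stack, extended by `pre` on the left. -/
def simMain (pre : List Γ) : Com (Proc Γ Q) (Cell Γ Q) :=
  .seq (.pushWord (pre.map .sym)) (.seq (.call .sim) (.seq (.pop .halt) (.call .popAll)))

/-- The configuration with state `q`, left part `L` and right part `R`, head included. -/
def tapeCfg (q : Q) (L : ListBlank Γ) (R : List Γ) : TM0.Cfg Γ Q :=
  ⟨q, Tape.mk' L (ListBlank.mk R)⟩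

/-- The machine halts when started in the given configuration. -/
def HaltsFrom (c : TM0.Cfg Γ Q) : Prop :=
  ∃ d, TM0.Reaches M c d ∧ TM0.step M d = none

theorem eval_dom_iff_haltsFrom (l : List Γ) :
    (TM0.eval M l).Dom ↔ HaltsFrom M (tapeCfg default (ListBlank.mk []) l) := by
  have : (TM0.eval M l).Dom ↔ (StateTransition.eval (TM0.step M) (TM0.init l)).Dom := Iff.rfl
  rw [this, Part.dom_iff_mem]
  simp only [StateTransition.mem_eval]
  rfl

/-- What is known about a call of a procedure on a stack that represents a tape. -/
def SimSpec : Proc Γ Q → List (Cell Γ Q) → List (Cell Γ Q) → Prop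
  | .state q, s, t => ∀ R : List Γ, s = R.map .sym →
      (∀ L, HaltsFrom M (tapeCfg q L R)) ∧ (∃ t', t = .halt :: t') ∨
      ∃ p R', t = .st p :: R'.map .sym ∧ ∀ X L,
        TM0.Reaches M (tapeCfg q (L.cons X) R) (tapeCfg p L (X :: R'))
  | .left a, s, t =>
      (∀ s', s = .halt :: s' → t = s) ∧
      ∀ p (R : List Γ), s = .st p :: R.map .sym →
      (∀ L, HaltsFrom M (tapeCfg p L (a :: R))) ∧ (∃ t', t = .halt :: t') ∨
      ∃ p' R', t = .st p' :: R'.map .sym ∧ ∀ X L,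
        TM0.Reaches M (tapeCfg p (L.cons X) (a :: R)) (tapeCfg p' L (X :: R'))
  | .sim, s, t => ∀ R : List Γ, s = R.map .sym →
      HaltsFrom M (tapeCfg default (ListBlank.mk []) R) ∧ (∃ t', t = .halt :: t') ∨
      ∃ p R', t = .st p :: R'.map .sym ∧
        TM0.Reaches M (tapeCfg default (ListBlank.mk []) R) (tapeCfg p (ListBlank.mk []) (default :: R'))
  | .popAll, _, _ => True

theorem HaltsFrom.of_reaches {c d : TM0.Cfg Γ Q} (h : TM0.Reaches M c d) (hd : HaltsFrom M d) :
    HaltsFrom M c := by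
  obtain ⟨e, h₁, h₂⟩ := hd
  exact ⟨e, h.trans h₁, h₂⟩

theorem step_tapeCfg_none {q : Q} {a : Γ} (h : M q a = none) (L R) :
    TM0.step M (tapeCfg q L (a :: R)) = none := by
  simp [TM0.step, tapeCfg, h]

theorem step_tapeCfg_write {q p : Q} {a b : Γ} (h : M q a = some (p, .write b)) (L R) :
    TM0.step M (tapeCfg q L (a :: R)) = some (tapeCfg p L (b :: R)) := by
  rw [tapeCfg, ← ListBlank.cons_mk]
  simp [TM0.step, tapeCfg, h, ← ListBlank.cons_mk]

theorem step_tapeCfg_right {q p : Q} {a : Γ} (h : M q a = some (p, .move .right)) (L R) :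
    TM0.step M (tapeCfg q L (a :: R)) = some (tapeCfg p (L.cons a) R) := by
  simp [TM0.step, tapeCfg, h]

theorem step_tapeCfg_left {q p : Q} {a : Γ} (h : M q a = some (p, .move .left)) (X L R) :
    TM0.step M (tapeCfg q (L.cons X) (a :: R)) = some (tapeCfg p L (X :: a :: R)) := by
  simp [TM0.step, tapeCfg, h]

/-- The configuration `c` halts after at most `k` steps. -/
def HaltsIn : ℕ → TM0.Cfg Γ Q → Prop
  | 0, c => TM0.step M c = none
  | k + 1, c => TM0.step M c = none ∨ ∃ d, TM0.step M c = some d ∧ HaltsIn k d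

theorem HaltsFrom.exists_haltsIn {c : TM0.Cfg Γ Q} (h : HaltsFrom M c) : ∃ k, HaltsIn M k c := by
  obtain ⟨d, h, hd⟩ := h
  induction h using Relation.ReflTransGen.head_induction_on with
  | refl => exact ⟨0, hd⟩
  | head h _ ih =>
    obtain ⟨k, hk⟩ := ih
    exact ⟨k + 1, .inr ⟨_, h, hk⟩⟩

theorem mk_append_replicate_default (l : List Γ) (k : ℕ) :
    ListBlank.mk (l ++ List.replicate k default) = ListBlank.mk l :=
  (Quotient.sound' (s₁ := BlankRel.setoid Γ) (Or.inl ⟨k, rfl⟩)).symm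

variable [Fintype Γ] [Fintype Q]

/-- The bodies of the procedures. The left part of the tape is the sequence of the pending calls,
the rest of the tape is on the stack. -/
noncomputable def simSys : Proc Γ Q → Com (Proc Γ Q) (Cell Γ Q)
  | .state q => .alts (Finset.univ.toList.map fun a => .seq (.pop (.sym a)) (readCom M q a))
  | .left a => .alt (.seq (.pop .halt) (.push .halt))
      (.alts (Finset.univ.toList.map fun p =>
        .seq (.pop (.st p)) (.seq (.push (.sym a)) (.call (.state p)))))
  | .sim => .alt (.call (.state default)) (.seq (.call .sim) (.call (.left default)))
  | .popAll => .alt .skip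
      (.alts (Finset.univ.toList.map fun a => .seq (.pop (.sym a)) (.call .popAll)))

/-- The specification is closed under the procedure bodies because a run from a cell splits at the
moments when the head crosses the left boundary of that cell. After a move to the right the scanned
symbol waits in a pending `left` call, which resumes the run when the head comes back or passes on
the halting signal. -/
theorem simSpec_of_den (f : Proc Γ Q) (s t : List (Cell Γ Q))
    (h : Com.Den False (SimSpec M) (simSys M f) s t) : SimSpec M f s t := by
  cases f with
  | state q =>
    intro R hR
    obtain ⟨c, hc, h⟩ := Com.den_alts.1 h
    obtain ⟨a, -, rfl⟩ := List.mem_map.1 hc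
    obtain ⟨u, h₁, h₂⟩ := h
    simp only [Com.Den] at h₁
    subst h₁
    obtain ⟨b, R, rfl⟩ : ∃ b R', R = b :: R' := by cases R <;> simp_all
    simp only [List.map_cons, List.cons.injEq, Cell.sym.injEq] at hR
    obtain ⟨rfl, rfl⟩ := hR
    unfold readCom at h₂
    split at h₂
    · rename_i hM
      simp only [Com.Den, false_and, or_false, exists_eq_left] at h₂
      exact .inl ⟨fun L => ⟨_, .refl, step_tapeCfg_none M hM L R⟩, _, h₂⟩
    · rename_i p b hM
      simp only [Com.Den, false_and, or_false, exists_eq_left] at h₂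
      rcases h₂ (b :: R) rfl with ⟨h, ht⟩ | ⟨p', R', ht, h⟩
      · exact .inl ⟨fun L => .of_reaches M (.single (step_tapeCfg_write M hM L R)) (h L), ht⟩
      · exact .inr ⟨p', R', ht, fun X L => .head (step_tapeCfg_write M hM _ R) (h X L)⟩
    · rename_i p hM
      simp only [Com.Den, false_and, or_false] at h₂
      obtain ⟨u, h₁, h₂⟩ := h₂
      rcases h₁ R rfl with ⟨h, t', rfl⟩ | ⟨p', R', rfl, h⟩
      · exact .inl ⟨fun L => .of_reaches M (.single (step_tapeCfg_right M hM L R)) (h _),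
          t', h₂.1 _ rfl⟩
      · have hr : ∀ L, TM0.Reaches M (tapeCfg q L (a :: R)) (tapeCfg p' L (a :: R')) :=
          fun L => .head (step_tapeCfg_right M hM L R) (h a L)
        rcases h₂.2 p' R' rfl with ⟨h', ht⟩ | ⟨p'', R'', rfl, h'⟩
        · exact .inl ⟨fun L => .of_reaches M (hr L) (h' L), ht⟩
        · exact .inr ⟨p'', R'', rfl, fun X L => (hr _).trans (h' X L)⟩
    · rename_i p hM
      simp only [Com.Den, false_and, or_false, exists_eq_left] at h₂
      exact .inr ⟨p, a :: R, h₂, fun X L => .single (step_tapeCfg_left M hM X L R)⟩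
  | left a =>
    simp only [simSys, Com.Den, Com.den_alts, List.mem_map, false_and, or_false] at h
    rcases h with ⟨u, rfl, rfl⟩ | ⟨c, ⟨p, -, rfl⟩, h⟩
    · simp [SimSpec]
    · simp only [Com.Den, false_and, or_false, exists_eq_left] at h
      obtain ⟨u, rfl, h⟩ := h
      refine ⟨by simp, fun p' R hR => ?_⟩
      simp only [List.cons.injEq, Cell.st.injEq] at hR
      obtain ⟨rfl, rfl⟩ := hR
      exact h (a :: R) rfl
  | sim =>
    simp only [simSys, Com.Den, false_and, or_false] at h
    -- A blank in front of an empty left half leaves it unchanged, so `sim` may supply a blank each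
    -- time the head leaves the represented tape.
    have hb : (ListBlank.mk ([] : List Γ)).cons default = ListBlank.mk [] :=
      ListBlank.cons_head_tail (ListBlank.mk [])
    intro R hR
    rcases h with h | ⟨u, h₁, h₂⟩
    · rcases h R hR with ⟨h', ht⟩ | ⟨p, R', ht, h'⟩
      · exact .inl ⟨h' _, ht⟩
      · exact .inr ⟨p, R', ht, by simpa only [hb] using h' default (ListBlank.mk [])⟩
    · rcases h₁ R hR with ⟨h, t', rfl⟩ | ⟨p, R', rfl, h⟩
      · exact .inl ⟨h, t', h₂.1 _ rfl⟩
      · rcases h₂.2 p R' rfl with ⟨h', ht⟩ | ⟨p', R'', rfl, h'⟩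
        · exact .inl ⟨.of_reaches M h (h' _), ht⟩
        · have e := h' default (ListBlank.mk [])
          rw [hb] at e
          exact .inr ⟨p', R'', rfl, h.trans e⟩
  | popAll => trivial

/-- A simulated run establishes that the machine halts. -/
theorem haltsFrom_of_exec (pre R : List Γ) (t : List (Cell Γ Q))
    (h : Com.Exec (simSys M) False (simMain pre) (R.map .sym) t) :
    HaltsFrom M (tapeCfg default (ListBlank.mk []) (pre ++ R)) := by
  obtain ⟨u, h₁, v, h₂, w, h₃, -⟩ := h.den (simSpec_of_den M)
  rw [Com.den_pushWord] at h₁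
  simp only [Com.Den, or_false, false_and] at h₂ h₃
  rcases h₂ (pre ++ R) (by simp [h₁]) with ⟨h, -⟩ | ⟨p, R', rfl, -⟩
  · exact h
  · simp at h₃

/-- Calls of the procedures of the symbols in `L`, one after the other. -/
inductive Unwind : List Γ → List (Cell Γ Q) → List (Cell Γ Q) → Prop
  | nil (s) : Unwind [] s s
  | cons {X L s t u} (h : Com.Exec (simSys M) False (.call (.left X)) s t) (h' : Unwind L t u) :
      Unwind (X :: L) s u

/-- Every pending call lets the halting signal pass unchanged. -/
theorem unwind_halt (L : List Γ) (s : List (Cell Γ Q)) :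
    Unwind M L (.halt :: s) (.halt :: s) := by
  induction L with
  | nil => exact .nil _
  | cons X L ih => exact .cons (.call (.altl (.seq (.pop _ _) (.push _ _)))) ih

theorem exec_state {q : Q} {a : Γ} {s t : List (Cell Γ Q)}
    (h : Com.Exec (simSys M) False (readCom M q a) s t) :
    Com.Exec (simSys M) False (.call (.state q)) (.sym a :: s) t :=
  .call (Com.exec_alts (List.mem_map.2 ⟨a, by simp, rfl⟩) (.seq (.pop _ _) h))

theorem exec_left {q : Q} {a : Γ} {s t : List (Cell Γ Q)}
    (h : Com.Exec (simSys M) False (.call (.state q)) (.sym a :: s) t) :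
    Com.Exec (simSys M) False (.call (.left a)) (.st q :: s) t :=
  .call (.altr (Com.exec_alts (List.mem_map.2 ⟨q, by simp, rfl⟩)
    (.seq (.pop _ _) (.seq (.push _ _) h))))

/-- The length bounds guarantee that the remaining `k` steps never leave the represented tape: each
move costs at most one cell on the side it goes to, and the strict bound on `R` keeps a cell under
the head. The unwinding of `L` is the continuation after the call returns. -/
theorem exec_of_haltsIn {k : ℕ} {q : Q} {L R : List Γ} (h : HaltsIn M k (tapeCfg q (.mk L) R))
    (hL : k ≤ L.length) (hR : k < R.length) : ∃ (u : List (Cell Γ Q)) (R' : List Γ),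
      Com.Exec (simSys M) False (.call (.state q)) (R.map .sym) u ∧
        Unwind M L u (.halt :: R'.map .sym) := by
  induction k generalizing q L R with
  | zero =>
    obtain ⟨a, R, rfl⟩ := List.exists_cons_of_length_pos hR
    simp only [HaltsIn, TM0.step, tapeCfg, Tape.mk'_head, ListBlank.head_mk, List.headI,
      Option.map_eq_none_iff] at h
    refine ⟨.halt :: .sym a :: R.map .sym, a :: R, exec_state M ?_, unwind_halt M _ _⟩
    simp only [readCom, h]
    exact .seq (.push _ _) (.push _ _)
  | succ k ih =>
    obtain ⟨a, R, rfl⟩ := List.exists_cons_of_length_pos (Nat.zero_lt_of_lt hR)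
    obtain ⟨X, L, rfl⟩ := List.exists_cons_of_length_pos (Nat.lt_of_lt_of_le k.succ_pos hL)
    simp only [List.length_cons, Nat.add_le_add_iff_right, Nat.add_lt_add_iff_right] at hL hR
    match hM : M q a with
    | none =>
      refine ⟨.halt :: .sym a :: R.map .sym, a :: R, exec_state M ?_, unwind_halt M _ _⟩
      simp only [readCom, hM]
      exact .seq (.push _ _) (.push _ _)
    | some (p, .write b) =>
      simp only [HaltsIn, step_tapeCfg_write M hM, reduceCtorEq, Option.some.injEq, false_or,
        exists_eq_left'] at h
      obtain ⟨u, R', h₁, h₂⟩ := ih h (by simp; omega) (by simp; omega)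
      refine ⟨u, R', exec_state M ?_, h₂⟩
      simp only [readCom, hM]
      exact .seq (.push _ _) h₁
    | some (p, .move .right) =>
      simp only [HaltsIn, step_tapeCfg_right M hM, reduceCtorEq, Option.some.injEq, false_or,
        exists_eq_left', ListBlank.cons_mk] at h
      obtain ⟨u, R', h₁, h₂⟩ := ih h (by simp; omega) (by omega)
      cases h₂ with
      | cons h₂ h₃ =>
        refine ⟨_, R', exec_state M ?_, h₃⟩
        simp only [readCom, hM]
        exact .seq h₁ h₂
    | some (p, .move .left) =>
      rw [← ListBlank.cons_mk] at h
      simp only [HaltsIn, step_tapeCfg_left M hM, reduceCtorEq, Option.some.injEq, false_or,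
        exists_eq_left'] at h
      obtain ⟨u, R', h₁, h₂⟩ := ih h (by omega) (by simp; omega)
      refine ⟨.st p :: .sym a :: R.map .sym, R', exec_state M ?_, .cons (exec_left M h₁) h₂⟩
      simp only [readCom, hM]
      exact .seq (.push _ _) (.push _ _)

/-- `sim` is left recursive, so a completed run of it can be extended by one more blank on the left
any number of times. -/
theorem exec_sim {k : ℕ} {s u t : List (Cell Γ Q)}
    (h : Com.Exec (simSys M) False (.call (.state default)) s u)
    (h' : Unwind M (List.replicate k default) u t) :
    Com.Exec (simSys M) False (.call .sim) s t := by
  have key : ∀ (k : ℕ) (s u t : List (Cell Γ Q)), Com.Exec (simSys M) False (.call .sim) s u →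
      Unwind M (List.replicate k default) u t → Com.Exec (simSys M) False (.call .sim) s t := by
    intro k
    induction k with
    | zero => intro s u t h h'; cases h'; exact h
    | succ k ih =>
      intro s u t h h'
      cases h' with
      | cons h₁ h₂ => exact ih _ _ _ (.call (.altr (.seq h h₁))) h₂
  exact key k s u t (.call (.altl h)) h'

theorem exec_popAll (R : List Γ) :
    Com.Exec (simSys M) False (.call .popAll) (R.map .sym) [] := by
  induction R with
  | nil => exact .call (.altl (.skip _))
  | cons a R ih => exact .call (.altr (Com.exec_alts (List.mem_map.2 ⟨a, by simp, rfl⟩)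
      (.seq (.pop _ _) ih)))

/-- A halting run can be simulated if sufficiently many blanks are provided. -/
theorem exists_exec_of_haltsFrom (pre R : List Γ)
    (h : HaltsFrom M (tapeCfg default (ListBlank.mk []) (pre ++ R))) :
    ∃ m, Com.Exec (simSys M) False (simMain pre)
      ((R ++ List.replicate m default).map .sym) [] := by
  obtain ⟨k, hk⟩ := h.exists_haltsIn M
  -- For a run of `k` steps, `k` blanks on the left and `k + 1` on the right suffice, the extra one
  -- because the head also needs a cell.
  refine ⟨k + 1, ?_⟩
  have e : tapeCfg (default : Q) (ListBlank.mk []) (pre ++ R) = tapeCfg default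
      (ListBlank.mk (List.replicate k default)) (pre ++ (R ++ List.replicate (k + 1) default)) := by
    have h₁ := mk_append_replicate_default (pre ++ R) (k + 1)
    have h₂ := mk_append_replicate_default ([] : List Γ) k
    rw [List.append_assoc] at h₁
    rw [List.nil_append] at h₂
    rw [tapeCfg, tapeCfg, h₁, h₂]
  rw [e] at hk
  obtain ⟨u, R', h₁, h₂⟩ := exec_of_haltsIn M hk (by simp) (by simp; omega)
  refine .seq (Com.exec_pushWord _ _) (.seq (exec_sim M (by simpa using h₁) h₂)
    (.seq (.pop _ _) (exec_popAll M R')))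

end Simulation
end Slicing

namespace Slicing

/-! ### Encoding a stack over a finite alphabet by selectors -/

/-- The code `1…10` of the `i`-th letter. -/
def codeNat (i : ℕ) : List Sel := List.replicate (i + 1) .one ++ [.zero]

section Encoding

variable {F A : Type} (idx : A → ℕ)

/-- The concatenation of the codes of the letters of a word. -/
def codeWord (l : List A) : List Sel := l.flatMap fun a => codeNat (idx a)

/-- Commands over selectors that treat the letters of a command over `A` by their codes. -/
def Com.translate : Com F A → Com F Sel
  | .skip => .skip
  | .fail => .fail
  | .push a => .pushWord (codeNat (idx a))
  | .pop a => .popWord (codeNat (idx a))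
  | .alt c d => .alt c.translate d.translate
  | .seq c d => .seq c.translate d.translate
  | .call f => .call f

/-- A stack that has lost its end marker, because it was cleared at some point. -/
def Truncated (s : List Sel) : Prop :=
  ∃ (l : List A) (j : ℕ), s = codeWord idx l ++ List.replicate j .one

/-- The stack that represents the word `l`. -/
def encodeStack (l : List A) : List Sel := codeWord idx l ++ [.zero]

theorem replicate_one_append_zero_inj {i j : ℕ} {s t : List Sel}
    (h : List.replicate i .one ++ .zero :: s = List.replicate j .one ++ .zero :: t) :
    i = j ∧ s = t := by
  induction i generalizing j with
  | zero => cases j <;> simp_all [List.replicate_succ]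
  | succ i ih =>
    cases j with
    | zero => simp [List.replicate_succ] at h
    | succ j =>
      simp only [List.replicate_succ, List.cons_append, List.cons.injEq, true_and] at h
      simpa using ih h

variable {idx}

/-- The codes form a prefix code, and neither possible tail can be mistaken for a code: the end
marker does not begin with `1`, and a run of `1`s contains no `0`. -/
theorem codeNat_append_eq (hidx : Function.Injective idx) {a : A} {l : List A}
    {r t : List Sel} (hr : r = [.zero] ∨ ∃ j, r = List.replicate j .one)
    (h : codeWord idx l ++ r = codeNat (idx a) ++ t) :
    ∃ l', l = a :: l' ∧ t = codeWord idx l' ++ r := by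
  cases l with
  | nil =>
    exfalso
    simp only [codeWord, List.flatMap_nil, List.nil_append, codeNat, List.append_assoc,
      List.cons_append] at h
    rcases hr with rfl | ⟨j, rfl⟩
    · simp [List.replicate_succ] at h
    · have : Sel.zero ∈ List.replicate j Sel.one := by rw [h]; simp
      simp [List.mem_replicate] at this
  | cons b l =>
    simp only [codeWord, List.flatMap_cons, codeNat, List.append_assoc, List.cons_append,
      List.nil_append] at h
    obtain ⟨h₁, h₂⟩ := replicate_one_append_zero_inj h
    obtain rfl := hidx (Nat.succ_injective h₁)
    exact ⟨l, rfl, h₂.symm⟩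

theorem codeNat_append_truncated (a : A) {s : List Sel} (h : Truncated idx s) :
    Truncated idx (codeNat (idx a) ++ s) := by
  obtain ⟨l, j, rfl⟩ := h
  exact ⟨a :: l, j, by simp [codeWord]⟩

/-- The only `0` of a code is its last letter. This is why an interrupted push or a cut inside a
code leaves nothing that could pass for an end marker. -/
theorem truncated_of_append_eq_codeNat {i : ℕ} {a : Sel} {s t : List Sel}
    (h : codeNat i = s ++ a :: t) : ∃ j, s = List.replicate j .one := by
  refine ⟨s.length, List.eq_replicate_iff.2 ⟨rfl, fun b hb => ?_⟩⟩
  have : s <+: List.replicate (i + 1) .one := by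
    have h₁ : s <+: codeNat i := ⟨_, h.symm⟩
    have h₂ : s.length ≤ i + 1 := by
      have := congrArg List.length h
      simp [codeNat] at this
      omega
    exact List.prefix_of_prefix_length_le h₁ (List.prefix_append _ _) (by simpa using h₂)
  exact List.eq_of_mem_replicate (this.subset hb)

theorem Com.exec_translate {sys : F → Com F A} {c : Com F A} {l l' : List A}
    (h : Exec sys False c l l') : Exec (fun f => (sys f).translate idx) False (c.translate idx)
      (encodeStack idx l) (encodeStack idx l') := by
  induction h with
  | skip => exact .skip _
  | push a s =>
    have := exec_pushWord (sys := fun f => (sys f).translate idx) (κ := False) (codeNat (idx a))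
      (encodeStack idx s)
    rwa [encodeStack, ← List.append_assoc] at this
  | pop a s =>
    have := exec_popWord (sys := fun f => (sys f).translate idx) (κ := False) (codeNat (idx a))
      (encodeStack idx s)
    rwa [encodeStack, ← List.append_assoc] at this
  | altl _ ih => exact .altl ih
  | altr _ ih => exact .altr ih
  | seq _ _ ih₁ ih₂ => exact .seq ih₁ ih₂
  | call _ ih => exact .call ih
  | clearFail h | clearPush h | clearAlt h | clearCall h => exact h.elim

/-- The effect of a translated command: clearing the stack cannot be undone. -/
def TranslateSpec (idx : A → ℕ) (sys : F → Com F A) (c : Com F A) (s t : List Sel) : Prop :=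
  (Truncated idx s → Truncated idx t) ∧
    ∀ l, s = encodeStack idx l → Truncated idx t ∨
      ∃ l', t = encodeStack idx l' ∧ Com.Exec sys False c l l'

theorem translateSpec_nil (sys : F → Com F A) (c : Com F A) (s : List Sel) :
    TranslateSpec idx sys c s [] :=
  have h : Truncated idx [] := ⟨[], 0, rfl⟩
  ⟨fun _ => h, fun _ _ => .inl h⟩

/-- Truncation is invariant: pushes put codes in front, and pops can only remove whole codes. A run
from a proper encoding thus either stays faithful to the original command or is truncated from some
moment on. -/
theorem translateSpec_of_den (hidx : Function.Injective idx) {sys : F → Com F A} {c : Com F A}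
    {s t : List Sel} (h : Com.Den True (fun f => TranslateSpec idx sys (.call f)) (c.translate idx) s t) :
    TranslateSpec idx sys c s t := by
  induction c generalizing s t with
  | skip =>
    obtain rfl : t = s := h
    exact ⟨id, fun l hl => .inr ⟨l, hl, .skip _⟩⟩
  | fail =>
    obtain ⟨-, rfl⟩ := h
    exact translateSpec_nil _ _ _
  | push a =>
    rcases Com.den_pushWord_clear h with rfl | ⟨b, v, hv⟩
    · refine ⟨codeNat_append_truncated a, fun l hl => .inr ⟨a :: l, ?_, .push a l⟩⟩
      simp [hl, encodeStack, codeWord]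
    · obtain ⟨j, rfl⟩ := truncated_of_append_eq_codeNat hv
      have : Truncated idx (List.replicate j Sel.one) := ⟨[], j, rfl⟩
      exact ⟨fun _ => this, fun _ _ => .inl this⟩
  | pop a =>
    obtain rfl := Com.den_popWord.1 h
    refine ⟨fun ⟨l, j, hl⟩ => ?_, fun l hl => ?_⟩
    · obtain ⟨l', rfl, rfl⟩ := codeNat_append_eq hidx (.inr ⟨j, rfl⟩) hl.symm
      exact ⟨l', j, rfl⟩
    · obtain ⟨l', rfl, rfl⟩ := codeNat_append_eq hidx (.inl rfl) hl.symm
      exact .inr ⟨l', rfl, .pop _ _⟩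
  | alt c d ihc ihd =>
    rcases h with h | h | ⟨-, rfl⟩
    · exact ⟨(ihc h).1, fun l hl => ((ihc h).2 l hl).imp_right
        fun ⟨l', h₁, h₂⟩ => ⟨l', h₁, .altl h₂⟩⟩
    · exact ⟨(ihd h).1, fun l hl => ((ihd h).2 l hl).imp_right
        fun ⟨l', h₁, h₂⟩ => ⟨l', h₁, .altr h₂⟩⟩
    · exact translateSpec_nil _ _ _
  | seq c d ihc ihd =>
    obtain ⟨u, h₁, h₂⟩ := h
    refine ⟨fun h => (ihd h₂).1 ((ihc h₁).1 h), fun l hl => ?_⟩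
    rcases (ihc h₁).2 l hl with h | ⟨l', h, e⟩
    · exact .inl ((ihd h₂).1 h)
    · exact ((ihd h₂).2 l' h).imp_right fun ⟨l'', h', e'⟩ => ⟨l'', h', .seq e e'⟩
  | call f =>
    rcases h with h | ⟨-, rfl⟩
    · exact h
    · exact translateSpec_nil _ _ _

theorem Com.translateSpec_of_exec (hidx : Function.Injective idx) {sys : F → Com F A} {c : Com F A}
    {s t : List Sel} (h : Exec (fun f => (sys f).translate idx) True (c.translate idx) s t) :
    TranslateSpec idx sys c s t := by
  refine translateSpec_of_den hidx (h.den fun f s t h => ?_)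
  have := translateSpec_of_den hidx h
  exact ⟨this.1, fun l hl => (this.2 l hl).imp_right fun ⟨l', h₁, h₂⟩ => ⟨l', h₁, .call h₂⟩⟩

/-- The translated command, followed by a test for the end marker. -/
def Com.translateMain (idx : A → ℕ) (c : Com F A) : Com F Sel :=
  .seq (c.translate idx) (.pop .zero)

theorem Com.exec_translateMain {sys : F → Com F A} {c : Com F A} {l : List A}
    (h : Exec sys False c l []) : Exec (fun f => (sys f).translate idx) False (c.translateMain idx)
      (encodeStack idx l) [] :=
  .seq (exec_translate h) (.pop _ _)

theorem not_truncated_zero_cons (t : List Sel) : ¬ Truncated idx (.zero :: t) := by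
  rintro ⟨l, j, h⟩
  cases l with
  | nil => cases j <;> simp [codeWord, List.replicate_succ] at h
  | cons a l => simp [codeWord, codeNat, List.replicate_succ] at h

/-- The final pop needs a `0` on top, which no truncated stack has. A successful run therefore
neither started truncated nor cleared the stack on the way. -/
theorem Com.exec_of_exec_translateMain (hidx : Function.Injective idx) {sys : F → Com F A}
    {c : Com F A} {s t : List Sel}
    (h : Exec (fun f => (sys f).translate idx) True (c.translateMain idx) s t) :
    ¬ Truncated idx s ∧ ∀ l, s = encodeStack idx l → ∃ l', Exec sys False c l l' := by
  cases h with
  | seq h₁ h₂ =>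
    cases h₂
    have h := translateSpec_of_exec hidx h₁
    exact ⟨fun hs => not_truncated_zero_cons _ (h.1 hs), fun l hl =>
      ((h.2 l hl).resolve_left (not_truncated_zero_cons _)).imp fun _ h => h.2⟩

/-- Proper prefixes of an encoded stack have lost the end marker. -/
theorem truncated_of_prefix {l : List A} {s : List Sel} (h : s <+: encodeStack idx l) :
    s = encodeStack idx l ∨ Truncated idx s := by
  induction l generalizing s with
  | nil =>
    rcases List.prefix_cons_iff.1 (show s <+: [Sel.zero] from h) with rfl | ⟨t, rfl, ht⟩
    · exact .inr ⟨[], 0, rfl⟩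
    · obtain rfl := List.prefix_nil.1 ht
      exact .inl rfl
  | cons a l ih =>
    have e : encodeStack idx (a :: l) = codeNat (idx a) ++ encodeStack idx l := by
      simp [encodeStack, codeWord]
    rw [e] at h ⊢
    rcases List.prefix_or_prefix_of_prefix h (List.prefix_append _ _) with h' | ⟨t, rfl⟩
    · obtain ⟨v, hv⟩ := h'
      cases v with
      | nil =>
        rw [List.append_nil] at hv
        rw [hv, ← List.append_nil (codeNat (idx a))]
        exact .inr (codeNat_append_truncated a ⟨[], 0, rfl⟩)
      | cons b v =>
        obtain ⟨j, rfl⟩ := truncated_of_append_eq_codeNat hv.symm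
        exact .inr ⟨[], j, rfl⟩
    · rw [List.prefix_append_right_inj] at h
      exact (ih h).imp (fun h => by rw [h]) (codeNat_append_truncated a)

end Encoding
end Slicing

namespace Slicing

/-! ### Programs from systems of elementary procedures -/

/-- Elementary procedures that call procedures with names in `I`. -/
inductive Shape (I : Type) where
  | skip
  | push (a : Sel)
  | pop (a : Sel)
  | alt (i j : I)
  | seq (i j : I)

/-- Rename the procedures. -/
def Shape.map {I J : Type} (f : I → J) : Shape I → Shape J
  | .skip => .skip
  | .push a => .push a
  | .pop a => .pop a
  | .alt i j => .alt (f i) (f j)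
  | .seq i j => .seq (f i) (f j)

/-- All called procedures satisfy `P`. -/
def Shape.All {I : Type} (P : I → Prop) : Shape I → Prop
  | .alt i j => P i ∧ P j
  | .seq i j => P i ∧ P j
  | _ => True

/-- The relation denoted by an elementary procedure. -/
def Shape.Den {I : Type} (κ : Prop) (E : I → List Sel → List Sel → Prop) :
    Shape I → List Sel → List Sel → Prop
  | .skip, s, t => t = s
  | .push a, s, t => t = a :: s ∨ κ ∧ t = []
  | .pop a, s, t => s = a :: t
  | .alt i j, s, t => E i s t ∨ E j s t ∨ κ ∧ t = []
  | .seq i j, s, t => ∃ u, E i s u ∧ E j u t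

/-- The summary nonterminal of a function with one parameter. -/
def summarySym (i : ℕ) : Sym := .nonterminal (.summary i 0)

/-- The words of the summary of an elementary procedure. -/
def Shape.words : Shape ℕ → List (List Sym)
  | .skip => [[]]
  | .push a => [[two], [sel a]]
  | .pop a => [[bar a]]
  | .alt i j => [[summarySym i], [summarySym j], [two]]
  | .seq i j => [[summarySym j, summarySym i]]

/-- The body of an elementary procedure; the labels are taken from `16 * n, …, 16 * n + 15`, the
parameter is `3 * n`, and the local variables are `3 * n + 1` and `3 * n + 2`. -/
def Shape.body (n : ℕ) : Shape ℕ → Expr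
  | .skip => .ret (16 * n) ⟨16 * n + 1, 3 * n⟩
  | .push .zero => .letIn (16 * n) (3 * n + 1) (.car (16 * n + 1) ⟨16 * n + 2, 3 * n⟩)
      (.ret (16 * n + 3) ⟨16 * n + 4, 3 * n + 1⟩)
  | .push .one => .letIn (16 * n) (3 * n + 1) (.cdr (16 * n + 1) ⟨16 * n + 2, 3 * n⟩)
      (.ret (16 * n + 3) ⟨16 * n + 4, 3 * n + 1⟩)
  | .pop .zero => .letIn (16 * n) (3 * n + 1) (.nil (16 * n + 1))
      (.letIn (16 * n + 2) (3 * n + 2)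
        (.cons (16 * n + 3) ⟨16 * n + 4, 3 * n⟩ ⟨16 * n + 5, 3 * n + 1⟩)
        (.ret (16 * n + 6) ⟨16 * n + 7, 3 * n + 2⟩))
  | .pop .one => .letIn (16 * n) (3 * n + 1) (.nil (16 * n + 1))
      (.letIn (16 * n + 2) (3 * n + 2)
        (.cons (16 * n + 3) ⟨16 * n + 4, 3 * n + 1⟩ ⟨16 * n + 5, 3 * n⟩)
        (.ret (16 * n + 6) ⟨16 * n + 7, 3 * n + 2⟩))
  | .alt i j => .ite (16 * n) ⟨16 * n + 1, 3 * n⟩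
      (.letIn (16 * n + 2) (3 * n + 1) (.call (16 * n + 3) i [⟨16 * n + 4, 3 * n⟩])
        (.ret (16 * n + 5) ⟨16 * n + 6, 3 * n + 1⟩))
      (.letIn (16 * n + 7) (3 * n + 2) (.call (16 * n + 8) j [⟨16 * n + 9, 3 * n⟩])
        (.ret (16 * n + 10) ⟨16 * n + 11, 3 * n + 2⟩))
  | .seq i j => .letIn (16 * n) (3 * n + 1) (.call (16 * n + 1) j [⟨16 * n + 2, 3 * n⟩])
      (.letIn (16 * n + 3) (3 * n + 2) (.call (16 * n + 4) i [⟨16 * n + 5, 3 * n + 1⟩])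
        (.ret (16 * n + 6) ⟨16 * n + 7, 3 * n + 2⟩))

/-- The function definition of an elementary procedure. -/
def Shape.funDef (n : ℕ) (S : Shape ℕ) : FunDef := ⟨n, [3 * n], S.body n⟩

/-- A main expression that calls the function `r`. -/
def mainExpr (n r : ℕ) : Expr :=
  .letIn (16 * n) (3 * n) (.nil (16 * n + 1))
    (.letIn (16 * n + 2) (3 * n + 1) (.call (16 * n + 3) r [⟨16 * n + 4, 3 * n⟩])
      (.ret (16 * n + 5) ⟨16 * n + 6, 3 * n + 1⟩))

/-- The program with the elementary procedures `sh 0, …, sh (N - 1)`, of which `r` is called. -/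
def shapeProgram (N : ℕ) (sh : ℕ → Shape ℕ) (r : ℕ) : Program :=
  ⟨(List.range N).map fun i => (sh i).funDef i, mainExpr N r⟩

/-- The argument of the call in the main expression. -/
def mainPoint (N : ℕ) : ℕ := 16 * N + 4

theorem Shape.div_of_mem_labels {n x : ℕ} {S : Shape ℕ} (h : x ∈ (S.body n).labels) :
    x / 16 = n := by
  rcases S with _ | (_ | _) | (_ | _) | _ | _ <;>
    simp [body, Expr.labels, Expr.exprLabels, Expr.apps, Expr.occs, App.label, App.occs] at h <;>
    omega

theorem div_of_mem_mainExpr_labels {n r x : ℕ} (h : x ∈ (mainExpr n r).labels) :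
    x / 16 = n := by
  simp [mainExpr, Expr.labels, Expr.exprLabels, Expr.apps, Expr.occs, App.label, App.occs] at h
  omega

theorem Shape.nodup_labels (n : ℕ) (S : Shape ℕ) : (S.body n).labels.Nodup := by
  rcases S with _ | (_ | _) | (_ | _) | _ | _ <;>
    simp [body, Expr.labels, Expr.exprLabels, Expr.apps, Expr.occs, App.label, App.occs]

theorem Shape.nodup_letVars (n : ℕ) (S : Shape ℕ) : (S.body n).letVars.Nodup := by
  rcases S with _ | (_ | _) | (_ | _) | _ | _ <;> simp [body, Expr.letVars]

theorem Shape.div_of_mem_letVars {n x : ℕ} {S : Shape ℕ} (h : x ∈ (S.body n).letVars) :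
    x / 3 = n ∧ x % 3 ≠ 0 := by
  rcases S with _ | (_ | _) | (_ | _) | _ | _ <;> simp [body, Expr.letVars] at h <;> omega

theorem nodup_mainExpr_labels (n r : ℕ) : (mainExpr n r).labels.Nodup := by
  simp [mainExpr, Expr.labels, Expr.exprLabels, Expr.apps, Expr.occs, App.label, App.occs]

/-- Each procedure owns a block of `k` consecutive numbers, recognised by the quotient; this is used
with `16` for labels and `3` for variables. -/
theorem nodup_flatMap_range {N : ℕ} {f : ℕ → List ℕ} (k : ℕ) (hf : ∀ i, (f i).Nodup)
    (hd : ∀ i, ∀ x ∈ f i, x / k = i) : ((List.range N).flatMap f).Nodup := by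
  refine List.nodup_flatMap.2 ⟨fun i _ => hf i, List.nodup_range.imp fun {i j} hij => ?_⟩
  exact fun x hi hj => hij ((hd i x hi).symm.trans (hd j x hj))

theorem nodup_append_flatMap_range {N k : ℕ} {f : ℕ → List ℕ} {l : List ℕ} (hl : l.Nodup)
    (hN : ∀ x ∈ l, x / k = N) (hf : ∀ i, (f i).Nodup) (hd : ∀ i, ∀ x ∈ f i, x / k = i) :
    (l ++ (List.range N).flatMap f).Nodup := by
  refine List.nodup_append.2 ⟨hl, nodup_flatMap_range k hf hd, fun a ha b hb e => ?_⟩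
  obtain ⟨i, hi, hb⟩ := List.mem_flatMap.1 hb
  have h₁ := hN a ha
  have h₂ := hd i b hb
  rw [List.mem_range] at hi
  subst e
  omega

theorem shapeProgram_wellFormed {N r : ℕ} {sh : ℕ → Shape ℕ} (hr : r < N)
    (hsh : ∀ i, i < N → (sh i).All (· < N)) : (shapeProgram N sh r).WellFormed where
  labels_nodup := by
    simp only [Program.labels, Program.bodies, shapeProgram, List.flatMap_cons, List.map_map,
      List.flatMap_map]
    exact nodup_append_flatMap_range (k := 16) (nodup_mainExpr_labels N r)
      (fun x => div_of_mem_mainExpr_labels) (fun i => (sh i).nodup_labels i)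
      fun i x => Shape.div_of_mem_labels
  names_nodup := by
    simpa [shapeProgram, Function.comp_def, Shape.funDef] using List.nodup_range
  vars_nodup := by
    simp only [Program.bodies, shapeProgram, List.flatMap_cons, List.map_map, List.flatMap_map]
    refine List.nodup_append.2 ⟨nodup_flatMap_range 3 (by simp [Shape.funDef])
      (by simp [Shape.funDef]), nodup_append_flatMap_range (k := 3)
        (by simp [mainExpr, Expr.letVars]) ?_ (fun i => (sh i).nodup_letVars i)
        fun i x h => (Shape.div_of_mem_letVars h).1, ?_⟩
    · simp [mainExpr, Expr.letVars]
      omega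
    · intro a ha b hb e
      subst e
      simp only [List.mem_flatMap, List.mem_range, Shape.funDef, List.mem_singleton] at ha
      obtain ⟨i, hi, rfl⟩ := ha
      rcases List.mem_append.1 hb with h | h
      · simp [mainExpr, Expr.letVars] at h
        omega
      · obtain ⟨j, -, h⟩ := List.mem_flatMap.1 h
        exact (Shape.div_of_mem_letVars h).2 (by omega)
  scoped_main := by
    simp [shapeProgram, mainExpr, Expr.Scoped, App.occs]
  scoped_defs := by
    simp only [shapeProgram, List.mem_map, List.mem_range]
    rintro _ ⟨i, -, rfl⟩
    rcases h : sh i with _ | (_ | _) | (_ | _) | _ | _ <;>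
      simp [Shape.funDef, Shape.body, Expr.Scoped, App.occs]
  calls := by
    have hdef : ∀ j < N, ∀ a : Occ, ∃ d ∈ (shapeProgram N sh r).defs, d.name = j ∧
        d.params.length = [a].length := fun j hj a =>
      ⟨(sh j).funDef j, List.mem_map.2 ⟨j, List.mem_range.2 hj, rfl⟩, rfl, rfl⟩
    intro e he π f args h
    simp only [Program.bodies, shapeProgram, List.mem_cons, List.mem_map, List.mem_range] at he
    rcases he with rfl | ⟨_, ⟨i, hi, rfl⟩, rfl⟩
    · simp only [mainExpr, Expr.apps, List.mem_cons, reduceCtorEq, App.call.injEq, false_or,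
        List.not_mem_nil, or_false] at h
      obtain ⟨-, rfl, rfl⟩ := h
      exact hdef _ hr _
    · have hs := hsh i hi
      rcases h' : sh i with _ | (_ | _) | (_ | _) | _ | _ <;> rw [h'] at h hs <;>
        simp [Shape.funDef, Shape.body, Expr.apps] at h
      · obtain ⟨-, rfl, rfl⟩ | ⟨-, rfl, rfl⟩ := h
        exacts [hdef _ hs.1 _, hdef _ hs.2 _]
      · obtain ⟨-, rfl, rfl⟩ | ⟨-, rfl, rfl⟩ := h
        exacts [hdef _ hs.2 _, hdef _ hs.1 _]

theorem mainPoint_mem (N r : ℕ) (sh : ℕ → Shape ℕ) :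
    mainPoint N ∈ (shapeProgram N sh r).labels := by
  simp [Program.labels, Program.bodies, shapeProgram, mainExpr, mainPoint, Expr.labels,
    Expr.exprLabels, Expr.apps, Expr.occs, App.label, App.occs]

/-! ### The productions of these programs -/

theorem NT.to_inj {A B : NT} {v w : List Sym} : A.to v = B.to w ↔ A = B ∧ v = w := by
  simp [NT.to]

/-- The demand analysis of the bodies yields exactly the intended stack operations, together with a
`2` from `car`, `cdr` or the condition of an `if`. In a composition the inner call is to the second
procedure, whose summary is leftmost and thus acts last. -/
theorem Shape.mem_summaryRules {n i k : ℕ} {S : Shape ℕ} {w : List Sym} :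
    (NT.summary i k).to w ∈ summaryRules (S.funDef n) ↔ i = n ∧ k = 0 ∧ w ∈ S.words := by
  have : summaryRules (S.funDef n) = S.words.map (NT.summary n 0).to := by
    rcases S with _ | (_ | _) | (_ | _) | _ | _ <;>
    simp [summaryRules, funDef, body, words, Expr.analyze, App.analyze, demandAt, Expr.occLabels,
      Expr.occs, App.occs, assign, Demand.pre, summarySym]
  rw [this]
  simp only [List.mem_map, NT.to_inj, NT.summary.injEq]
  constructor
  · rintro ⟨_, h, ⟨rfl, rfl⟩, rfl⟩
    exact ⟨rfl, rfl, h⟩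
  · rintro ⟨rfl, rfl, h⟩
    exact ⟨w, h, ⟨rfl, rfl⟩, rfl⟩

theorem Shape.div_of_mem_analyze {n x : ℕ} {S : Shape ℕ} {σ : Demand} {w : List Sym}
    (h : (x, w) ∈ (S.body n).analyze σ) : x / 16 = n := by
  rcases S with _ | (_ | _) | (_ | _) | _ | _ <;>
    simp [body, Expr.analyze, App.analyze, assign, List.mem_append, List.mem_map] at h <;>
    omega

theorem mem_mainExpr_analyze {n r : ℕ} {A : Sym} {w : List Sym} :
    (mainPoint n, w) ∈ (mainExpr n r).analyze [[A]] ↔ w = [summarySym r, A] := by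
  simp [mainExpr, mainPoint, Expr.analyze, App.analyze, assign, demandAt, Expr.occLabels, Expr.occs,
    App.occs, Demand.pre, summarySym]

variable {N r : ℕ} {sh : ℕ → Shape ℕ} {c : Criterion}

theorem mem_contextFreeRules_summary {i k : ℕ} {w : List Sym} :
    (NT.summary i k).to w ∈ contextFreeRules (shapeProgram N sh r) c ↔
      i < N ∧ k = 0 ∧ w ∈ (sh i).words := by
  simp only [contextFreeRules, List.mem_append, demandRules, bodyRules, critRules, List.mem_map,
    List.mem_flatMap, List.mem_cons, NT.to_inj, reduceCtorEq, false_and, and_false, exists_false,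
    or_false, false_or, shapeProgram, List.mem_range]
  constructor
  · rintro ⟨_, ⟨j, hj, rfl⟩, h⟩
    obtain ⟨rfl, rfl, hw⟩ := Shape.mem_summaryRules.1 h
    exact ⟨hj, rfl, hw⟩
  · rintro ⟨hi, rfl, h⟩
    exact ⟨_, ⟨i, hi, rfl⟩, Shape.mem_summaryRules.2 ⟨rfl, rfl, h⟩⟩

theorem not_mem_summaryRules {d : FunDef} {A : NT} {w : List Sym} (hA : ∀ i k, A ≠ .summary i k) :
    A.to w ∉ summaryRules d := by
  simp only [summaryRules, List.mem_flatMap, List.mem_map, NT.to_inj, not_exists, not_and]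
  rintro _ _ _ _ h
  exact absurd h.symm (hA _ _)

theorem mem_contextFreeRules_mainPoint {w : List Sym} :
    (NT.demand (mainPoint N)).to w ∈ contextFreeRules (shapeProgram N sh r) c ↔
      w = [summarySym r, .nonterminal .bodyMain] := by
  have hs : ∀ d, (NT.demand (mainPoint N)).to w ∉ summaryRules d := fun d =>
    not_mem_summaryRules (by simp)
  simp only [contextFreeRules, List.mem_append, demandRules, bodyRules, critRules, List.mem_map,
    List.mem_flatMap, List.mem_cons, NT.to_inj, reduceCtorEq, false_and, and_false, exists_false,
    or_false, shapeProgram, List.mem_range, hs, NT.demand.injEq]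
  constructor
  · rintro (⟨⟨π, v⟩, h, rfl, rfl⟩ | ⟨_, ⟨j, hj, rfl⟩, ⟨π, v⟩, h, rfl, rfl⟩)
    · exact mem_mainExpr_analyze.1 h
    · have := Shape.div_of_mem_analyze h
      simp only [mainPoint] at this
      omega
  · rintro rfl
    exact .inl ⟨_, mem_mainExpr_analyze.2 rfl, rfl, rfl⟩

theorem mem_contextFreeRules_bodyMain {p : Program} {w : List Sym} :
    NT.bodyMain.to w ∈ contextFreeRules p c ↔ w = [.nonterminal (.crit c.start)] := by
  have hs : ∀ d, NT.bodyMain.to w ∉ summaryRules d := fun d => not_mem_summaryRules (by simp)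
  simp [contextFreeRules, List.mem_append, demandRules, bodyRules, critRules, hs, NT.to_inj]

theorem mem_contextFreeRules_crit {p : Program} {n : ℕ} {w : List Sym} :
    (NT.crit n).to w ∈ contextFreeRules p c ↔ ∃ v B, RProd.mk n v B ∈ c.prods ∧
      w = v.map sel ++ B.toList.map fun B => .nonterminal (.crit B) := by
  have hs : ∀ d, (NT.crit n).to w ∉ summaryRules d := fun d => not_mem_summaryRules (by simp)
  simp only [contextFreeRules, List.mem_append, demandRules, bodyRules, critRules, hs, NT.to_inj,
    List.mem_map, List.mem_flatMap, List.mem_cons, reduceCtorEq, false_and, and_false, exists_false,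
    or_false, false_or, NT.crit.injEq]
  constructor
  · rintro ⟨⟨_, v, B⟩, h, rfl, rfl⟩
    exact ⟨v, B, h, rfl⟩
  · rintro ⟨v, B, h, rfl⟩
    exact ⟨_, h, rfl, rfl⟩

theorem exists_eq_to_of_mem_contextFreeRules {p : Program} {ρ : Rule}
    (h : ρ ∈ contextFreeRules p c) : ∃ A w, ρ = NT.to A w ∧ A ≠ .start ∧ A ≠ .two ∧
      ∀ a, A ≠ .bar a := by
  simp only [contextFreeRules, List.mem_append, demandRules, bodyRules, critRules, summaryRules,
    List.mem_map, List.mem_flatMap, List.mem_cons] at h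
  rcases h with (((⟨_, _, rfl⟩ | ⟨_, _, _, _, rfl⟩) | ⟨_, _, _, _, _, _, rfl⟩) |
    ⟨_, _, _, _, rfl⟩) | rfl | ⟨_, _, rfl⟩ <;> exact ⟨_, _, rfl, by simp⟩

end Slicing

namespace Slicing

/-! ### Emptiness of the slice language -/

/-- The relation between stacks denoted by a grammar symbol, if the nonterminals denote `E`. -/
def symSem (E : NT → List Sel → List Sel → Prop) : Sym → List Sel → List Sel → Prop
  | .terminal (.sel a), s, t => t = a :: s
  | .terminal .eos, _, t => t = []
  | .nonterminal A, s, t => E A s t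

/-- The relation denoted by a sentential form, the rightmost symbol acting first. -/
def wordSem (E : NT → List Sel → List Sel → Prop) : List Sym → List Sel → List Sel → Prop
  | [], s, t => t = s
  | x :: w, s, t => ∃ u, wordSem E w s u ∧ symSem E x u t

theorem wordSem_append {E : NT → List Sel → List Sel → Prop} {v w : List Sym} {s t : List Sel} :
    wordSem E (v ++ w) s t ↔ ∃ u, wordSem E w s u ∧ wordSem E v u t := by
  induction v generalizing t with
  | nil => simp [wordSem]
  | cons x v ih =>
    simp only [List.cons_append, wordSem, ih]
    constructor
    · rintro ⟨u, ⟨m, h₁, h₂⟩, h₃⟩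
      exact ⟨m, h₁, u, h₂, h₃⟩
    · rintro ⟨m, h₁, u, h₂, h₃⟩
      exact ⟨u, ⟨m, h₁, h₂⟩, h₃⟩

theorem exists_wordSem_terminal (E : NT → List Sel → List Sel → Prop) (w : List Terminal)
    (s : List Sel) : ∃ t, wordSem E (w.map .terminal) s t := by
  induction w with
  | nil => exact ⟨s, rfl⟩
  | cons x w ih =>
    obtain ⟨t, h⟩ := ih
    cases x with
    | sel a => exact ⟨_, t, h, rfl⟩
    | eos => exact ⟨_, t, h, rfl⟩

theorem wordSem_map_sel {E : NT → List Sel → List Sel → Prop} {w s t : List Sel} :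
    wordSem E (w.map sel) s t ↔ t = w ++ s := by
  induction w generalizing t with
  | nil => simp [wordSem]
  | cons a w ih => simp [wordSem, ih, symSem, sel]

/-- Containment of right-hand sides in left-hand sides is preserved in every context, because words
denote compositions. Hence the meaning of a derived word is contained in that of the word it comes
from. -/
theorem wordSem_of_reachable {T : List Rule} {G : UGrammar Terminal NT}
    {E : NT → List Sel → List Sel → Prop} (hG : G.rules = T)
    (hE : ∀ ρ ∈ T, ∀ s t, wordSem E ρ.2 s t → wordSem E ρ.1 s t) {v w : List Sym}
    (h : Relation.ReflTransGen G.Produces v w) {s t : List Sel} (hw : wordSem E w s t) :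
    wordSem E v s t := by
  induction h using Relation.ReflTransGen.head_induction_on with
  | refl => exact hw
  | head h _ ih =>
    obtain ⟨ρ, hρ, p, q, rfl, rfl⟩ := h
    obtain ⟨u, h₁, h₂⟩ := wordSem_append.1 ih
    obtain ⟨m, h₂, h₃⟩ := wordSem_append.1 h₂
    exact wordSem_append.2 ⟨u, h₁, wordSem_append.2 ⟨m, hE ρ (hG ▸ hρ) _ _ h₂, h₃⟩⟩

theorem reachable_append {G : UGrammar Terminal NT} {v w : List Sym}
    (h : Relation.ReflTransGen G.Produces v w) (x y : List Sym) :
    Relation.ReflTransGen G.Produces (x ++ v ++ y) (x ++ w ++ y) := by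
  induction h with
  | refl => exact .refl
  | tail _ h ih =>
    obtain ⟨ρ, hρ, p, q, rfl, rfl⟩ := h
    exact ih.tail ⟨ρ, hρ, x ++ p, q ++ y, by simp, by simp⟩

theorem reachable_of_mem {G : UGrammar Terminal NT} {A : NT} {w : List Sym}
    (h : A.to w ∈ G.rules) (x y : List Sym) :
    Relation.ReflTransGen G.Produces (x ++ .nonterminal A :: y) (x ++ w ++ y) :=
  .single ⟨_, h, x, y, by simp [NT.to], rfl⟩

section

variable {N r : ℕ} {sh : ℕ → Shape ℕ} {c : Criterion}

/-- The relations denoted by the nonterminals of the grammar of a program of elementary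
procedures, where the `i`-th procedure denotes `E i`. -/
def ntSem (N r : ℕ) (c : Criterion) (E : ℕ → List Sel → List Sel → Prop) :
    NT → List Sel → List Sel → Prop
  | .start, _, _ => ∃ m t, c.Gen c.start m ∧ E r m t
  | .demand π, s, t => π = mainPoint N → s = [] → ∃ m, c.Gen c.start m ∧ E r m t
  | .summary i _, s, t => E i s t
  | .body _, _, _ => True
  | .bodyMain, s, t => s = [] → c.Gen c.start t
  | .crit n, s, t => s = [] → c.Gen n t
  | .bar a, s, t => s = a :: t
  | .two, _, t => t = []

theorem wordSem_of_mem_words {E : ℕ → List Sel → List Sel → Prop} {S : Shape ℕ} {w : List Sym}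
    (hw : w ∈ S.words) {s t : List Sel} (h : wordSem (ntSem N r c E) w s t) : S.Den True E s t := by
  rcases S with _ | a | a | _ | _ <;> simp [Shape.words] at hw
  · subst hw
    simpa [wordSem, Shape.Den] using h
  · rcases hw with rfl | rfl <;>
      simp_all [wordSem, Shape.Den, two, sel, symSem, ntSem]
  · subst hw
    simpa [wordSem, Shape.Den, bar, symSem, ntSem] using h
  · rcases hw with rfl | rfl | rfl <;>
      simp_all [wordSem, Shape.Den, two, summarySym, symSem, ntSem]
  · subst hw
    simpa [wordSem, Shape.Den, summarySym, symSem, ntSem] using h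

/-- The model `ntSem` validates all productions. The end marker acts first and empties the stack, so
the demand at the main point and the criterion need to be described on the empty stack only; demands
at other points and on function bodies are irrelevant and are left unconstrained. The simplification
rules hold because popping undoes pushing and clearing absorbs whatever acted before it. -/
theorem exists_of_mem_language {E : ℕ → List Sel → List Sel → Prop}
    (hE : ∀ i, i < N → ∀ s t, (sh i).Den True E s t → E i s t) {w : List Terminal}
    (hw : w ∈ (sliceGrammar (shapeProgram N sh r) (mainPoint N) c).language) :
    ∃ m t, c.Gen c.start m ∧ E r m t := by
  obtain ⟨t, ht⟩ := exists_wordSem_terminal (ntSem N r c E) w []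
  have key := wordSem_of_reachable (E := ntSem N r c E) rfl ?_ hw ht
  · obtain ⟨u, -, h⟩ := key
    exact h
  clear ht hw t
  intro ρ hρ s t h
  simp only [sliceGrammar, List.mem_append, List.mem_singleton] at hρ
  rcases hρ with (hρ | hρ) | rfl
  · obtain ⟨A, w, rfl, h₁, h₂, h₃⟩ := exists_eq_to_of_mem_contextFreeRules hρ
    refine ⟨s, rfl, ?_⟩
    simp only [NT.to] at h
    cases A with
    | start => exact absurd rfl h₁
    | demand π =>
      rintro rfl rfl
      rw [mem_contextFreeRules_mainPoint] at hρ
      subst hρ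
      obtain ⟨m, ⟨_, rfl, hm⟩, h⟩ := h
      exact ⟨m, hm rfl, h⟩
    | summary i k =>
      obtain ⟨hi, rfl, hw⟩ := mem_contextFreeRules_summary.1 hρ
      exact hE i hi s t (wordSem_of_mem_words hw h)
    | body f => trivial
    | bodyMain =>
      rintro rfl
      rw [mem_contextFreeRules_bodyMain] at hρ
      subst hρ
      obtain ⟨_, rfl, hm⟩ := h
      exact hm rfl
    | crit n =>
      rintro rfl
      obtain ⟨v, B, hB, rfl⟩ := mem_contextFreeRules_crit.1 hρ
      obtain ⟨u, h₁, h₂⟩ := wordSem_append.1 h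
      rw [wordSem_map_sel] at h₂
      subst h₂
      cases B with
      | none =>
        obtain rfl : u = [] := h₁
        rw [List.append_nil]
        exact .last hB
      | some B =>
        obtain ⟨_, rfl, h₁⟩ := h₁
        exact .step hB (h₁ rfl)
    | bar a => exact absurd rfl (h₃ a)
    | two => exact absurd rfl h₂
  · simp only [unrestrictedRules, List.mem_cons, List.not_mem_nil, or_false] at hρ
    rcases hρ with rfl | rfl | rfl | rfl | rfl <;>
      simp_all [wordSem, symSem, bar, sel, two, eos, ntSem]
  · obtain ⟨_, ⟨_, rfl, rfl⟩, h⟩ := h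
    refine ⟨_, rfl, ?_⟩
    obtain ⟨m, hm⟩ := h rfl rfl
    exact ⟨m, t, hm⟩

theorem reachable_of_gen {p : Program} {π n : ℕ} {m : List Sel} (h : c.Gen n m) :
    Relation.ReflTransGen (sliceGrammar p π c).Produces [.nonterminal (.crit n)] (m.map sel) := by
  induction h with
  | last h =>
    have := reachable_of_mem (G := sliceGrammar p π c) (List.mem_append_left _
      (List.mem_append_left _ (mem_contextFreeRules_crit.2 ⟨_, _, h, rfl⟩))) [] []
    simpa using this
  | @step A B w v h _ ih =>
    have := reachable_of_mem (G := sliceGrammar p π c) (List.mem_append_left _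
      (List.mem_append_left _ (mem_contextFreeRules_crit.2 ⟨_, _, h, rfl⟩))) [] []
    have h' := reachable_append ih (w.map sel) []
    simp only [List.nil_append, List.append_nil, Option.toList_some, List.map_cons,
      List.map_nil] at this h'
    rw [List.map_append]
    exact this.trans h'

theorem reachable_bar {G : UGrammar Terminal NT} (hG : ∀ ρ ∈ unrestrictedRules, ρ ∈ G.rules)
    (a : Sel) (s : List Sel) :
    Relation.ReflTransGen G.Produces (bar a :: (a :: s).map sel) (s.map sel) := by
  refine .single ⟨([bar a, sel a], []), hG _ ?_, [], s.map sel, rfl, rfl⟩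
  cases a <;> simp [unrestrictedRules]

/-- The summary of the `i`-th procedure transforms the path `s` into the path `t`. -/
def SummaryReaches (N r : ℕ) (sh : ℕ → Shape ℕ) (c : Criterion) (i : ℕ) (s t : List Sel) : Prop :=
  Relation.ReflTransGen (sliceGrammar (shapeProgram N sh r) (mainPoint N) c).Produces
    (summarySym i :: s.map sel) (t.map sel)

/-- Choosing the production without `2` realises each operation by a derivation. The selectors to
the right of a summary hold the current stack, and a pop is one cancellation of a barred selector.
-/
theorem SummaryReaches.of_den {i : ℕ} (hi : i < N) {s t : List Sel}
    (h : (sh i).Den False (SummaryReaches N r sh c) s t) : SummaryReaches N r sh c i s t := by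
  have step : ∀ w ∈ (sh i).words, Relation.ReflTransGen
      (sliceGrammar (shapeProgram N sh r) (mainPoint N) c).Produces
      (summarySym i :: s.map sel) (w ++ s.map sel) := fun w hw =>
    reachable_of_mem (List.mem_append_left _ (List.mem_append_left _
      (mem_contextFreeRules_summary.2 ⟨hi, rfl, hw⟩))) [] _
  generalize sh i = S at h step
  rcases S with _ | a | a | ⟨j, k⟩ | ⟨j, k⟩ <;>
    simp only [Shape.Den, Shape.words, List.mem_cons, List.not_mem_nil, or_false, forall_eq,
      forall_eq_or_imp, false_and] at h step
  · subst h
    exact step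
  · subst h
    exact step.2
  · subst h
    exact step.trans (reachable_bar (fun ρ hρ => by simp [sliceGrammar, hρ]) a t)
  · rcases h with h | h
    · exact step.1.trans h
    · exact step.2.1.trans h
  · obtain ⟨u, h₁, h₂⟩ := h
    have := reachable_append h₁ [summarySym k] []
    simp only [List.append_nil] at this
    exact (step.trans this).trans h₂

theorem nonempty_language {m t : List Sel} (hm : c.Gen c.start m)
    (h : SummaryReaches N r sh c r m t) :
    (sliceGrammar (shapeProgram N sh r) (mainPoint N) c).language.Nonempty := by
  refine ⟨t.map .sel ++ [.eos], ?_⟩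
  have h₁ := reachable_of_mem (G := sliceGrammar (shapeProgram N sh r) (mainPoint N) c) (A := .start)
    (w := [.nonterminal (.demand (mainPoint N)), eos]) (by simp [sliceGrammar]) [] []
  have h₂ := reachable_of_mem (G := sliceGrammar (shapeProgram N sh r) (mainPoint N) c)
    (List.mem_append_left _ (List.mem_append_left _ (mem_contextFreeRules_mainPoint.2 rfl)))
    [] [eos]
  have h₃ := reachable_of_mem (G := sliceGrammar (shapeProgram N sh r) (mainPoint N) c)
    (List.mem_append_left _ (List.mem_append_left _ (mem_contextFreeRules_bodyMain.2 rfl)))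
    [summarySym r] [eos]
  have h₄ := reachable_append (reachable_of_gen (p := shapeProgram N sh r) (π := mainPoint N) hm)
    [summarySym r] [eos]
  have h₅ := reachable_append h [] [eos]
  have e : (t.map Terminal.sel ++ [Terminal.eos]).map Symbol.terminal =
      (t.map sel ++ [eos] : List Sym) := by
    simp [sel, eos, Function.comp_def]
  change Relation.ReflTransGen _ _ _
  rw [e]
  exact (((h₁.trans h₂).trans h₃).trans h₄).trans h₅

end

/-! ### Numbering the procedures of a system -/

namespace Com

variable {F : Type}

/-- The elementary procedure of a command. -/
def shape (sys : F → Com F Sel) : Com F Sel → Shape (Com F Sel)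
  | .skip => .skip
  | .fail => .alt .fail .fail
  | .push a => .push a
  | .pop a => .pop a
  | .alt c d => .alt c d
  | .seq c d => .seq c d
  | .call f => .alt (sys f) (sys f)

/-- The commands of which a command is composed. -/
def subterms : Com F Sel → List (Com F Sel)
  | .alt c d => .alt c d :: (c.subterms ++ d.subterms)
  | .seq c d => .seq c d :: (c.subterms ++ d.subterms)
  | c => [c]

theorem self_mem_subterms (c : Com F Sel) : c ∈ c.subterms := by
  cases c <;> simp [subterms]

theorem all_shape_of_mem_subterms {sys : F → Com F Sel} {P : Com F Sel → Prop} {e : Com F Sel}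
    (he : ∀ c ∈ e.subterms, P c) (hsys : ∀ f, P (sys f)) : ∀ c ∈ e.subterms, (c.shape sys).All P := by
  induction e with
  | skip | push | pop => simp [subterms, shape, Shape.All]
  | fail => simpa [subterms, shape, Shape.All] using he
  | call f => simp [subterms, shape, Shape.All, hsys]
  | alt c d ihc ihd | seq c d ihc ihd =>
    intro x hx
    simp only [subterms, List.mem_cons, List.mem_append] at hx he
    rcases hx with rfl | hx | hx
    · exact ⟨he _ (.inr (.inl c.self_mem_subterms)), he _ (.inr (.inr d.self_mem_subterms))⟩
    · exact ihc (fun x hx => he x (.inr (.inl hx))) x hx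
    · exact ihd (fun x hx => he x (.inr (.inr hx))) x hx

/-- All commands that occur in a command or in a procedure. -/
noncomputable def closure [Fintype F] (sys : F → Com F Sel) (e : Com F Sel) : List (Com F Sel) :=
  e.subterms ++ Finset.univ.toList.flatMap fun f => (sys f).subterms

variable [Fintype F] {sys : F → Com F Sel} {e : Com F Sel}

theorem self_mem_closure : e ∈ closure sys e := List.mem_append_left _ e.self_mem_subterms

/-- Finitely many commands are closed under taking components and unfolding calls, so one function
per command gives a finite program. -/
theorem all_shape_of_mem_closure {c : Com F Sel} (hc : c ∈ closure sys e) :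
    (c.shape sys).All (· ∈ closure sys e) := by
  have hsys : ∀ f, ∀ d ∈ (sys f).subterms, d ∈ closure sys e := fun f d hd =>
    List.mem_append_right _ (List.mem_flatMap.2 ⟨f, by simp, hd⟩)
  have hf : ∀ f, sys f ∈ closure sys e := fun f => hsys f _ (self_mem_subterms _)
  rcases List.mem_append.1 hc with h | h
  · exact all_shape_of_mem_subterms (fun c hc => List.mem_append_left _ hc) hf c h
  · obtain ⟨f, -, h⟩ := List.mem_flatMap.1 h
    exact all_shape_of_mem_subterms (hsys f) hf c h

open scoped Classical in
/-- The number of a command. -/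
noncomputable def index (sys : F → Com F Sel) (e c : Com F Sel) : ℕ := (closure sys e).idxOf c

/-- The command with a given number. -/
noncomputable def ofIndex (sys : F → Com F Sel) (e : Com F Sel) (i : ℕ) : Com F Sel :=
  (closure sys e).getD i .skip

theorem index_lt {c : Com F Sel} (hc : c ∈ closure sys e) :
    index sys e c < (closure sys e).length := by
  classical exact List.idxOf_lt_length_iff.2 hc

theorem ofIndex_index {c : Com F Sel} (hc : c ∈ closure sys e) :
    ofIndex sys e (index sys e c) = c := by
  classical
  rw [ofIndex, List.getD_eq_getElem _ _ (index_lt hc)]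
  exact List.getElem_idxOf _

theorem ofIndex_mem {i : ℕ} (hi : i < (closure sys e).length) :
    ofIndex sys e i ∈ closure sys e := by
  rw [ofIndex, List.getD_eq_getElem _ _ hi]
  exact List.getElem_mem hi

/-- The elementary procedures of a system. -/
noncomputable def numberedShape (sys : F → Com F Sel) (e : Com F Sel) (i : ℕ) : Shape ℕ :=
  ((ofIndex sys e i).shape sys).map (index sys e)

/-- The program of a system. -/
noncomputable def program (sys : F → Com F Sel) (e : Com F Sel) : Program :=
  shapeProgram (closure sys e).length (numberedShape sys e) (index sys e e)

theorem program_wellFormed : (program sys e).WellFormed := by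
  refine shapeProgram_wellFormed (index_lt self_mem_closure) fun i hi => ?_
  have h := all_shape_of_mem_closure (ofIndex_mem hi)
  unfold numberedShape
  cases hs : (ofIndex sys e i).shape sys <;> rw [hs] at h <;>
    simp only [Shape.map, Shape.All] at h ⊢
  all_goals exact ⟨index_lt h.1, index_lt h.2⟩

/-- The point of the argument of the call of `e`. -/
noncomputable def point (sys : F → Com F Sel) (e : Com F Sel) : ℕ :=
  mainPoint (closure sys e).length

/-- Execution with clearing is itself a model of the elementary procedures. Failure and calls are
compiled to choices between two equal branches, an endless loop in the case of failure; the `2` of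
the choice is the reason why these commands may also clear the stack. -/
theorem exists_exec_of_nonempty {c : Criterion}
    (h : (sliceGrammar (program sys e) (point sys e) c).language.Nonempty) :
    ∃ m t, c.Gen c.start m ∧ Exec sys True e m t := by
  obtain ⟨w, hw⟩ := h
  have := exists_of_mem_language (E := fun i => Exec sys True (ofIndex sys e i)) ?_ hw
  · simpa only [ofIndex_index self_mem_closure] using this
  intro i hi s t h
  have hc := all_shape_of_mem_closure (ofIndex_mem hi)
  unfold numberedShape at h
  generalize ofIndex sys e i = d at h hc ⊢
  cases d <;> simp only [shape, Shape.map, Shape.Den, Shape.All] at h hc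
  · subst h
    exact .skip _
  · rw [ofIndex_index hc.1] at h
    rcases h with h | h | ⟨-, rfl⟩
    exacts [h, h, .clearFail trivial _]
  · rcases h with rfl | ⟨-, rfl⟩
    exacts [.push _ _, .clearPush trivial _ _]
  · subst h
    exact .pop _ _
  · rw [ofIndex_index hc.1, ofIndex_index hc.2] at h
    rcases h with h | h | ⟨-, rfl⟩
    exacts [.altl h, .altr h, .clearAlt trivial _ _ _]
  · rw [ofIndex_index hc.1, ofIndex_index hc.2] at h
    obtain ⟨u, h₁, h₂⟩ := h
    exact .seq h₁ h₂
  · rw [ofIndex_index hc.1] at h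
    rcases h with h | h | ⟨-, rfl⟩
    exacts [.call h, .call h, .clearCall trivial _ _]

theorem summaryReaches_of_exec {c : Criterion} {d : Com F Sel} {s t : List Sel}
    (h : Exec sys False d s t) (hd : d ∈ closure sys e) :
    SummaryReaches (closure sys e).length (index sys e e) (numberedShape sys e) c
      (index sys e d) s t := by
  have step : ∀ {d s t}, d ∈ closure sys e → ((d.shape sys).map (index sys e)).Den False
      (SummaryReaches (closure sys e).length (index sys e e) (numberedShape sys e) c) s t →
      SummaryReaches (closure sys e).length (index sys e e) (numberedShape sys e) c
        (index sys e d) s t := fun hd h =>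
    .of_den (index_lt hd) (by rwa [numberedShape, ofIndex_index hd])
  have hc := all_shape_of_mem_closure hd
  induction h with
  | skip => exact step hd rfl
  | push => exact step hd (.inl rfl)
  | pop => exact step hd rfl
  | altl h ih => exact step hd (.inl (ih hc.1 (all_shape_of_mem_closure hc.1)))
  | altr h ih => exact step hd (.inr (.inl (ih hc.2 (all_shape_of_mem_closure hc.2))))
  | seq h₁ h₂ ih₁ ih₂ => exact step hd ⟨_, ih₁ hc.1 (all_shape_of_mem_closure hc.1),
      ih₂ hc.2 (all_shape_of_mem_closure hc.2)⟩
  | call h ih => exact step hd (.inl (ih hc.1 (all_shape_of_mem_closure hc.1)))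
  | clearFail h | clearPush h | clearAlt h | clearCall h => exact h.elim

theorem nonempty_of_exec {c : Criterion} {m t : List Sel} (hm : c.Gen c.start m)
    (h : Exec sys False e m t) :
    (sliceGrammar (program sys e) (point sys e) c).language.Nonempty :=
  nonempty_language hm (summaryReaches_of_exec h self_mem_closure)

end Com
end Slicing

namespace Slicing
open Turing

/-! ### The slicing criteria -/

/-- A criterion for the prefixes of the words `uⁿ bᵐ 0`. -/
def inputCriterion (u b : List Sel) (n : ℕ) : Criterion :=
  ⟨n, (⟨0, b, some 0⟩ :: ⟨0, [.zero], none⟩ :: b.inits.map fun v => ⟨0, v, none⟩) ++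
    (List.range n).flatMap fun k =>
      ⟨k + 1, u, some k⟩ :: u.inits.map fun v => ⟨k + 1, v, none⟩⟩

/-- The word `uᵏ bᵐ 0`. -/
def inputWord (u b : List Sel) (k m : ℕ) : List Sel :=
  (List.replicate k u).flatten ++ ((List.replicate m b).flatten ++ [.zero])

theorem mem_inputCriterion {u b v : List Sel} {n A : ℕ} {B : Option ℕ} :
    RProd.mk A v B ∈ (inputCriterion u b n).prods ↔
      A = 0 ∧ (v = b ∧ B = some 0 ∨ v = [.zero] ∧ B = none ∨ v <+: b ∧ B = none) ∨
      ∃ k < n, A = k + 1 ∧ (v = u ∧ B = some k ∨ v <+: u ∧ B = none) := by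
  simp only [inputCriterion, List.mem_append, List.mem_cons, List.mem_map, List.mem_flatMap,
    List.mem_range, RProd.mk.injEq, List.mem_inits]
  constructor
  · rintro ((⟨rfl, rfl, rfl⟩ | ⟨rfl, rfl, rfl⟩ | ⟨w, hw, rfl, rfl, rfl⟩) |
      ⟨k, hk, ⟨rfl, rfl, rfl⟩ | ⟨w, hw, rfl, rfl, rfl⟩⟩)
    · simp
    · simp
    · simp [hw]
    · exact .inr ⟨k, hk, by simp⟩
    · exact .inr ⟨k, hk, by simp [hw]⟩
  · rintro (⟨rfl, ⟨rfl, rfl⟩ | ⟨rfl, rfl⟩ | ⟨hw, rfl⟩⟩ |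
      ⟨k, hk, rfl, ⟨rfl, rfl⟩ | ⟨hw, rfl⟩⟩)
    · simp
    · simp
    · exact .inl (.inr (.inr ⟨v, hw, rfl, rfl, rfl⟩))
    · exact .inr ⟨k, hk, .inl ⟨rfl, rfl, rfl⟩⟩
    · exact .inr ⟨k, hk, .inr ⟨v, hw, rfl, rfl, rfl⟩⟩

/-- The nonterminal `k` counts the copies of `u` still to come, and `0` loops on `b`; every
derivation may stop inside the current block. -/
theorem exists_prefix_of_gen {u b w : List Sel} {n k : ℕ} (h : (inputCriterion u b n).Gen k w) :
    ∃ m, w <+: inputWord u b k m := by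
  induction h with
  | last h =>
    rcases mem_inputCriterion.1 h with ⟨rfl, ⟨-, h⟩ | ⟨rfl, -⟩ | ⟨h, -⟩⟩ |
      ⟨k, -, rfl, ⟨-, h⟩ | ⟨h, -⟩⟩
    · simp at h
    · exact ⟨0, by simp [inputWord]⟩
    -- Stopping inside a copy of `b` requires one such copy in the full word.
    · exact ⟨1, h.trans (by simp [inputWord])⟩
    · simp at h
    · exact ⟨0, h.trans (by simp [inputWord, List.replicate_succ])⟩
  | step h _ ih =>
    obtain ⟨m, ih⟩ := ih
    rcases mem_inputCriterion.1 h with ⟨rfl, ⟨rfl, hB⟩ | ⟨-, hB⟩ | ⟨-, hB⟩⟩ |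
      ⟨k, -, rfl, ⟨rfl, hB⟩ | ⟨-, hB⟩⟩ <;>
      simp only [Option.some.injEq, reduceCtorEq] at hB
    · subst hB
      refine ⟨m + 1, ?_⟩
      simpa [inputWord, List.replicate_succ] using ih
    · subst hB
      refine ⟨m, ?_⟩
      simpa [inputWord, List.replicate_succ] using ih

theorem gen_of_prefix {u b w : List Sel} {n k m : ℕ} (hk : k ≤ n) (h : w <+: inputWord u b k m) :
    (inputCriterion u b n).Gen k w := by
  induction k generalizing w with
  | zero =>
    induction m generalizing w with
    | zero =>
      rcases List.prefix_cons_iff.1 (show w <+: [Sel.zero] from h) with rfl | ⟨t, rfl, ht⟩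
      · exact .last (mem_inputCriterion.2 (by simp))
      · obtain rfl := List.prefix_nil.1 ht
        exact .last (mem_inputCriterion.2 (by simp))
    | succ m ih =>
      have e : inputWord u b 0 (m + 1) = b ++ inputWord u b 0 m := by
        simp [inputWord, List.replicate_succ]
      rw [e] at h
      rcases List.prefix_or_prefix_of_prefix h (List.prefix_append _ _) with h' | ⟨t, rfl⟩
      · exact .last (mem_inputCriterion.2 (by simp [h']))
      · rw [List.prefix_append_right_inj] at h
        exact .step (mem_inputCriterion.2 (by simp)) (ih h)
  | succ k ih =>
    have e : inputWord u b (k + 1) m = u ++ inputWord u b k m := by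
      simp [inputWord, List.replicate_succ]
    rw [e] at h
    rcases List.prefix_or_prefix_of_prefix h (List.prefix_append _ _) with h' | ⟨t, rfl⟩
    · exact .last (mem_inputCriterion.2 (.inr ⟨k, hk, rfl, .inr ⟨h', rfl⟩⟩))
    · rw [List.prefix_append_right_inj] at h
      exact .step (mem_inputCriterion.2 (.inr ⟨k, hk, rfl, .inl ⟨rfl, rfl⟩⟩)) (ih (by omega) h)

theorem inputCriterion_prefixClosed (u b : List Sel) (n : ℕ) :
    (inputCriterion u b n).PrefixClosed := by
  intro v w h
  obtain ⟨m, hm⟩ := exists_prefix_of_gen h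
  exact gen_of_prefix le_rfl ((List.prefix_append v w).trans hm)

theorem computable_inputCriterion_code (u b : List Sel) :
    Computable fun n => (inputCriterion u b n).code := by
  -- The inner `0` is the code of `none`, and `x` stands for the code of a fixed word.
  have hp : ∀ x : ℕ, Primrec fun k : ℕ => Nat.pair (k + 1) (Nat.pair x 0) := fun x =>
    Primrec₂.natPair.comp Primrec.succ (Primrec.const _)
  have hl : ∀ l : List (List Sel), Primrec fun k : ℕ =>
      l.map fun v => (RProd.mk (k + 1) v none).code := by
    intro l
    induction l with
    | nil => exact Primrec.const []
    | cons v l ih => exact Primrec.list_cons.comp (hp (Encodable.encode (v.map Sel.code))) ih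
  have hb : Primrec fun k : ℕ => (RProd.mk (k + 1) u (some k)).code ::
      u.inits.map fun v => (RProd.mk (k + 1) v none).code :=
    Primrec.list_cons.comp (Primrec₂.natPair.comp Primrec.succ
      (Primrec₂.natPair.comp (Primrec.const (Encodable.encode (u.map Sel.code)))
        (Primrec.encode.comp Primrec.option_some))) (hl _)
  have h : Primrec fun n : ℕ => Nat.pair n (Encodable.encode
      (((RProd.mk 0 b (some 0) :: ⟨0, [.zero], none⟩ ::
        b.inits.map fun v => RProd.mk 0 v none).map RProd.code) ++
        (List.range n).flatMap fun k => (RProd.mk (k + 1) u (some k)).code ::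
          u.inits.map fun v => (RProd.mk (k + 1) v none).code)) :=
    Primrec₂.natPair.comp Primrec.id (Primrec.encode.comp (Primrec.list_append.comp
      (Primrec.const _) (Primrec.list_flatMap Primrec.list_range (hb.comp Primrec.snd).to₂)))
  refine h.to_comp.of_eq fun n => ?_
  simp only [Criterion.code, inputCriterion, List.map_append, List.map_flatMap, List.map_cons,
    List.map_map, Function.comp_def]

/-! ### The reduction from the halting problem -/

theorem encodeStack_input {Γ Q : Type} (idx : Cell Γ Q → ℕ) (z b : Γ) (n m : ℕ) :
    encodeStack idx ((List.replicate n z ++ List.replicate m b).map .sym) =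
      inputWord (codeNat (idx (.sym z))) (codeNat (idx (.sym b))) n m := by
  simp [encodeStack, codeWord, inputWord, List.flatMap_def]

theorem exists_injective_cell (Γ Q : Type) [Fintype Γ] [Fintype Q] :
    ∃ f : Cell Γ Q → ℕ, Function.Injective f := by
  have : Function.Injective fun c : Cell Γ Q => (match c with
      | .sym a => some (.inl a) | .st q => some (.inr q) | .halt => none : Option (Γ ⊕ Q)) := by
    rintro (_ | _ | _) (_ | _ | _) <;> simp
  have := this.countable
  exact Countable.exists_injective_nat _

theorem finite_proc (Γ Q : Type) [Fintype Γ] [Fintype Q] : Finite (Proc Γ Q) := by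
  refine Finite.of_injective (fun c : Proc Γ Q => (match c with
    | .left a => .inl (some a) | .state q => .inr (some q) | .sim => .inl none
    | .popAll => .inr none : Option Γ ⊕ Option Q)) ?_
  rintro (_ | _ | _ | _) (_ | _ | _ | _) <;> simp

/-- A fixed program and a fixed point of it for which it is undecidable whether the slice language
of a given criterion is nonempty. -/
theorem exists_program_undecidable : ∃ (p : Program) (π : ℕ) (u b : List Sel),
    p.WellFormed ∧ π ∈ p.labels ∧
    ¬ ComputablePred fun n => (sliceGrammar p π (inputCriterion u b n)).language.Nonempty := by
  obtain ⟨Γ, Q, _, _, _, _, M, pre, z, hM⟩ := exists_turing_machine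
  obtain ⟨idx, hidx⟩ := exists_injective_cell Γ Q
  have := finite_proc Γ Q
  have := Fintype.ofFinite (Proc Γ Q)
  let sys := fun f => (simSys M f).translate idx
  let e := (simMain pre).translateMain (F := Proc Γ Q) idx
  refine ⟨Com.program sys e, Com.point sys e, codeNat (idx (.sym z)), codeNat (idx (.sym default)),
    Com.program_wellFormed, mainPoint_mem _ _ _, ?_⟩
  convert hM using 3 with n
  rw [eval_dom_iff_haltsFrom]
  constructor
  · intro h
    obtain ⟨s, t, hs, h⟩ := Com.exists_exec_of_nonempty h
    obtain ⟨m, hm⟩ := exists_prefix_of_gen hs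
    change s <+: inputWord _ _ n m at hm
    rw [← encodeStack_input] at hm
    obtain ⟨h₁, h₂⟩ := Com.exec_of_exec_translateMain hidx h
    -- A proper prefix would be truncated, so the path taken from the criterion is a complete input
    -- followed by `m` blanks.
    obtain ⟨t', ht'⟩ := h₂ _ ((truncated_of_prefix hm).resolve_right h₁)
    have := haltsFrom_of_exec M pre _ _ ht'
    -- The guessed trailing blanks do not change the tape.
    rw [tapeCfg, ← List.append_assoc, mk_append_replicate_default] at this
    exact this
  · intro h
    obtain ⟨m, hm⟩ := exists_exec_of_haltsFrom M pre _ h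
    have := Com.exec_translateMain (idx := idx) hm
    rw [encodeStack_input] at this
    exact Com.nonempty_of_exec (gen_of_prefix le_rfl List.prefix_rfl) this

end Slicing

theorem theorem4p1 :
    ¬ ∃ decider : ℕ → Bool, Computable decider ∧
      ∀ I : Slicing.SliceQuery, I.WellFormed →
        (decider I.code = true ↔ I.grammar.language = ∅) := by
  rintro ⟨decider, hd, h⟩
  obtain ⟨p, π, u, b, hp, hπ, hu⟩ := Slicing.exists_program_undecidable
  refine hu (ComputablePred.computable_iff.2 ⟨fun n => !decider (Slicing.SliceQuery.code
    ⟨p, π, Slicing.inputCriterion u b n⟩), ?_, ?_⟩)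
  · exact Primrec.not.to_comp.comp (hd.comp (Primrec₂.natPair.to_comp.comp (Computable.const p.code)
      (Primrec₂.natPair.to_comp.comp (Computable.const π)
        (Slicing.computable_inputCriterion_code u b))))
  · funext n
    have := h ⟨p, π, Slicing.inputCriterion u b n⟩
      ⟨hp, hπ, Slicing.inputCriterion_prefixClosed u b n⟩
    rw [← Set.not_nonempty_iff_eq_empty] at this
    simp only [Slicing.SliceQuery.grammar] at this
    simp only [Bool.not_eq_true', ← Bool.not_eq_true, this, not_not]
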